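/- Let $F$ be a non-archimedean local field with ring of integers $\mathcal O$ and uniformizer $\pi$. Let $G'=\{g\in GL_3(F):\det g\in\pi^{\mathbb Z}\}/(\pi^{\mathbb Z}\,\mathrm{Id})$, with its natural (quotient) topology, let $K=SL_3(\mathcal O)\subset G'$, and for $i,j\in\mathbb N$ let $D(i,j)\in G'$ be the class of $\mathrm{diag}(\pi^{-(i+j)},\pi^{-j},1)$. Every element of $G'$ can be written $k\,D(i,j)\,k'$ with $k,k'\in K$ and unique $i,j\in\mathbb N$; put $\ell(k\,D(i,j)\,k')=i+j$. Let $\Lambda=\{(i,j)\in\mathbb N^2: i-j\in 3\mathbb Z\}$. For a finite abelian group $A$ with dual group $\hat A$ and a complex Banach space $E$, let $T_A\otimes 1_E:\ell^2(A,E)\to\ell^2(\hat A,E)$ be the operator $f\mapsto\big(\chi\mapsto\frac1{\# A}\sum_{x\in A}\chi(x)f(x)\big)$, where $\ell^2(I,E)$ carries the norm $\big(\frac1{\# I}\sum_{x\in I}\|f(x)\|^2\big)^{1/2}$ for a finite set $I$. Let $h\ge 1$ be an integer, $\alpha>0$, and let $\mathcal E$ be a class of complex Banach spaces such that $\|T_{\mathcal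 O/\pi^h\mathcal O}\otimes 1_E\|\le e^{-\alpha}$ for every $E\in\mathcal E$. Let $\beta\in[0,\frac{\alpha}{3h})$. Then there exists $C'>0$ such that the following holds for every real $C\ge 0$. Let $\pi_E$ be a continuous representation of $G'$ on a Banach space $E\in\mathcal E$ (that is, $g\mapsto\pi_E(g)v$ is continuous for every $v\in E$) such that $\|\pi_E(g)\|\le e^{C+\beta\ell(g)}$ for all $g\in G'$. Let $\xi\in E$ and $\eta\in E^*$ be $K$-invariant vectors of norm $1$ ($E^*$ carrying the contragredient representation $g\mapsto{}^t\pi_E(g^{-1})$), and put $c(i,j)=\langle\eta,\pi_E(D(i,j))\xi\rangle$ for $i,j\in\mathbb N$. Then there is $c_\infty\in\mathbb C$ such that the restriction of $c$ to $\Lambda$ tends to $c_\infty$ at infinity, and $$|c(i,j)-c_\infty|\le C'e^{2C-(\frac{\alpha}{3h}-\beta)(i+j)}\qquad\text{for all }(i,j)\in\Lambda.$$ -/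

import Mathlib

open scoped ValuativeRel

universe u v

noncomputable section

/-! ### The vector-valued Fourier transform on a finite abelian group -/

namespace FiniteFourier

/-- The normalised norm `(𝔼_{x ∈ I} ‖f x‖²)^{1/2}` of a function `f : I → E` on a finite set,
that is, the norm of `ℓ²(I, E)`. -/
def avgNorm {I E : Type*} [Fintype I] [NormedAddCommGroup E] (f : I → E) : ℝ :=
  Real.sqrt ((∑ x, ‖f x‖ ^ 2) / Fintype.card I)

/-- The operator `T_G ⊗ 1_E`: it sends `f : G → E` to
`χ ↦ 𝔼_{x ∈ G} χ(x) f(x)`, a function on the dual group. -/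
def transform {G E : Type*} [AddCommGroup G] [Finite G] [NormedAddCommGroup E] [NormedSpace ℂ E]
    (f : G → E) (χ : AddChar G ℂ) : E :=
  letI := Fintype.ofFinite G
  ((Fintype.card G : ℂ)⁻¹) • ∑ x, χ x • f x

/-- The operator norm of `T_G ⊗ 1_E : ℓ²(G, E) → ℓ²(Ĝ, E)`: the least `c ≥ 0` such that
`‖(T_G ⊗ 1_E) f‖ ≤ c ‖f‖` for all `f`. -/
def transformNorm (G E : Type*) [AddCommGroup G] [Finite G] [NormedAddCommGroup E]
    [NormedSpace ℂ E] : ℝ :=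
  letI := Fintype.ofFinite G
  sInf {c : ℝ | 0 ≤ c ∧ ∀ f : G → E, avgNorm (transform f) ≤ c * avgNorm f}

end FiniteFourier

/-- A class of complex Banach spaces. -/
abbrev BanachClass : Type (v + 1) :=
  ∀ (E : Type v) [NormedAddCommGroup E] [NormedSpace ℂ E] [CompleteSpace E], Prop

/-! ### The group `G'`, its compact subgroup `K` and its length -/

namespace LocalSL3

section Groups

variable {F : Type*} [Field F]

/-- A uniformizer `ϖ` of the ring of integers `𝒪[F]`, as a unit of `F`. -/
def unif [ValuativeRel F] (ϖ : 𝒪[F]) [hϖ : Fact (Irreducible ϖ)] : Fˣ :=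
  Units.mk0 (ϖ : F) fun h => hϖ.out.ne_zero (Subtype.ext h)

/-- The subgroup `{g ∈ GL₃(F) | det g ∈ u^ℤ}` of `GL₃(F)`. -/
def detPowers (u : Fˣ) : Subgroup (GL (Fin 3) F) :=
  (Subgroup.zpowers u).comap Matrix.GeneralLinearGroup.det

/-- The subgroup `u^ℤ Id` of `{g ∈ GL₃(F) | det g ∈ u^ℤ}`. -/
def scalarPowers (u : Fˣ) : Subgroup (detPowers u) :=
  (Subgroup.zpowers (Matrix.GeneralLinearGroup.scalar (Fin 3) u)).subgroupOf (detPowers u)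

instance (u : Fˣ) : (scalarPowers u).Normal := by
  refine ⟨fun n hn g => ?_⟩
  have hc : g * n = n * g := by
    obtain ⟨k, hk⟩ := Subgroup.mem_zpowers_iff.mp (Subgroup.mem_subgroupOf.mp hn)
    apply Subtype.ext
    change (g : GL (Fin 3) F) * n = n * g
    rw [← hk, ← map_zpow]
    exact (Matrix.GeneralLinearGroup.scalar_commute _ _).symm
  rwa [hc, mul_inv_cancel_right]

/-- The group `G' = {g ∈ GL₃(F) | det g ∈ u^ℤ} / (u^ℤ Id)`; for topological `F` it carries the
quotient topology of the subspace topology of `GL₃(F)`. -/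
abbrev GPrime (u : Fˣ) : Type _ := detPowers u ⧸ scalarPowers u

/-- The natural homomorphism `SL₃(𝒪) → G'`. -/
def integralHom [ValuativeRel F] (u : Fˣ) : Matrix.SpecialLinearGroup (Fin 3) 𝒪[F] →* GPrime u :=
  (QuotientGroup.mk' (scalarPowers u)).comp
    ((Matrix.SpecialLinearGroup.toGL.comp
        (Matrix.SpecialLinearGroup.map (algebraMap 𝒪[F] F))).codRestrict (detPowers u)
      (fun k => by simp [detPowers]))

/-- The subgroup `K = SL₃(𝒪)` of `G'`. -/
def maxCompact [ValuativeRel F] (u : Fˣ) : Subgroup (GPrime u) := (integralHom u).range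

/-- The diagonal matrix `diag(u^{-(i+j)}, u^{-j}, 1)` in `GL₃(F)`. -/
def diagGL (u : Fˣ) (i j : ℕ) : GL (Fin 3) F :=
  Matrix.GeneralLinearGroup.mkOfDetNeZero
    !![((u ^ (-((i : ℤ) + j)) : Fˣ) : F), 0, 0; 0, ((u ^ (-(j : ℤ)) : Fˣ) : F), 0; 0, 0, 1]
    (by
      rw [Matrix.det_fin_three]
      simp [-Units.val_zpow_eq_zpow_val])

theorem diagGL_mem (u : Fˣ) (i j : ℕ) : diagGL u i j ∈ detPowers u := by
  refine Subgroup.mem_zpowers_iff.mpr ⟨-((i : ℤ) + j) + -(j : ℤ), ?_⟩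
  apply Units.ext
  rw [zpow_add]
  simp [diagGL, Matrix.GeneralLinearGroup.mkOfDetNeZero, Matrix.det_fin_three]

/-- The class of `diag(u^{-(i+j)}, u^{-j}, 1)` in `G'`. -/
def diagElt (u : Fˣ) (i j : ℕ) : GPrime u :=
  QuotientGroup.mk (⟨diagGL u i j, diagGL_mem u i j⟩ : detPowers u)

/-- The length `ℓ` on `G'`, given by `ℓ(k · diag(u^{-(i+j)}, u^{-j}, 1) · k') = i + j` for
`k, k' ∈ K` and `i, j ∈ ℕ`. When `u` is a uniformizer every element of `G'` has such a
decomposition, with unique `i` and `j`, so that the set below has exactly one element. -/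
def length [ValuativeRel F] (u : Fˣ) (g : GPrime u) : ℕ :=
  sInf {n : ℕ | ∃ i j : ℕ, ∃ k ∈ maxCompact u, ∃ k' ∈ maxCompact u,
    g = k * diagElt u i j * k' ∧ n = i + j}

/-- The set `Λ = {(i, j) ∈ ℕ² | i - j ∈ 3ℤ}`. -/
def weightSet : Set (ℕ × ℕ) := {p | (3 : ℤ) ∣ (p.1 : ℤ) - p.2}

end Groups

end LocalSL3

/-! ### Representations -/

section Representations

variable {G : Type*} [Group G] {E : Type*} [NormedAddCommGroup E] [NormedSpace ℂ E]

/-- `(E, π)` belongs to the class `𝓔_{G, L}` of (strongly) continuous representations of `G` on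
Banach spaces `E` of the class `𝓔` with `‖π(g)‖ ≤ e^{L(g)}` for all `g ∈ G`. -/
structure MemRepClass [TopologicalSpace G] [CompleteSpace E] (𝓔 : BanachClass) (L : G → ℝ)
    (π : G →* (E →L[ℂ] E)) : Prop where
  mem : 𝓔 E
  continuous (v : E) : Continuous fun g => π g v
  norm_le (g : G) : ‖π g‖ ≤ Real.exp (L g)

/-- `ξ ∈ E` is invariant under the subgroup `K`. -/
def IsInvariantVector (K : Subgroup G) (π : G →* (E →L[ℂ] E)) (ξ : E) : Prop :=
  ∀ k ∈ K, π k ξ = ξ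

/-- `η ∈ E*` is invariant under the subgroup `K` for the contragredient representation
`g ↦ ᵗπ(g⁻¹)`. -/
def IsInvariantForm (K : Subgroup G) (π : G →* (E →L[ℂ] E)) (η : StrongDual ℂ E) : Prop :=
  ∀ k ∈ K, η.comp (π k⁻¹) = η

end Representations

/-- The quotient `𝒪 / π^h 𝒪` of the ring of integers of a non-archimedean local field is
finite. -/
instance finite_integer_quotient {F : Type*} [Field F] [ValuativeRel F] [TopologicalSpace F]
    [IsNonarchimedeanLocalField F] (ϖ : 𝒪[F]) [hϖ : Fact (Irreducible ϖ)] (h : ℕ) :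
    Finite (𝒪[F] ⧸ Ideal.span {ϖ ^ h}) := by
  have hm := hϖ.out.maximalIdeal_eq
  have : Finite (𝒪[F] ⧸ Ideal.span {ϖ}) := by
    rw [← hm]; exact inferInstanceAs (Finite 𝓀[F])
  rw [← Ideal.span_singleton_pow]
  exact Ideal.finite_quotient_pow ⟨{ϖ}, by simp⟩ h

end

/-! By `K`-invariance, `c` depends only on double cosets, that is, on elementary divisors up to a
common power of `ϖ`. For `b ≤ a`, a corner matrix with diagonal exponents `b, c, a` and corner entry
`s` has its double coset determined by the valuation of `s`, cut off at `b`. It also factors, up to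
unipotent elements of `SL₃(𝒪)`, as `A(x,t) B(y,z)` whenever `s = z - t - x y`. Hence the jump of the
coefficient from `s ∈ ϖ^b 𝒪` to `s` of valuation `b - 1` is a pairing with the discrete Radon
transform `𝔼_y ζ(y, t + x y)`, where `ζ` is obtained from the vectors `π(B(y,z)) ξ` by projecting,
in the variable `z`, onto a character primitive modulo `ϖ^b`.

On such functions the Radon transform factors like a fast Fourier transform: every block of `h`
digits costs one Fourier transform on `𝒪/ϖ^h` and gains `e^{-α}`, so its norm is at most
`e^{-α⌊b/h⌋}` (`mean_radon_le`). With `norm_jump_le` and `norm_coeff_sub_le` this bounds the jumps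
of `c` on either side of the diagonal (`norm_coeff_sub_le_of_le`, `norm_coeff_sub_le_of_ge`).

The two factors have norms at most `e^{C+βa}` and `e^{C+βb}`. In the half-plane where a move is
used, `a + b ≤ 3b`, so the gain wins because `β < α/(3h)` (`jump_bound`). Chaining moves towards the
diagonal and along it, one sums a geometric series and obtains the limit (`exists_limit_of_jumps`).
-/

noncomputable section

namespace FiniteFourier

/-! ### Averages over `R / pⁿ`, written with periodic functions on `R`. -/

section Periodic

variable {R : Type*} [CommRing R]

/-- Invariance of a function on `R` under translation by `pⁿ R`. -/
def Periodic (p : R) (n : ℕ) {X : Type*} (f : R → X) : Prop := ∀ x w, f (x + p ^ n * w) = f x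

lemma Periodic.eq_of_mk_eq {p : R} {n : ℕ} {X : Type*} {f : R → X} (hf : Periodic p n f) {x y : R}
    (h : Ideal.Quotient.mk (Ideal.span {p ^ n}) x = Ideal.Quotient.mk _ y) : f x = f y := by
  rw [Ideal.Quotient.eq, Ideal.mem_span_singleton] at h
  obtain ⟨w, hw⟩ := h
  rw [← hf y w, ← hw]
  congr 1
  ring

lemma mk_out {p : R} {n : ℕ} (u : R ⧸ Ideal.span {p ^ n}) :
    Ideal.Quotient.mk (Ideal.span {p ^ n}) u.out = u := Quotient.out_eq u

/-- The bijection `R / pᵃ × R / pᵇ → R / p^(a+b)` given by `(u, v) ↦ u + pᵃ v` on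
representatives. -/
lemma digit_bijective [IsDomain R] {p : R} (hp : p ≠ 0) (a b : ℕ) :
    Function.Bijective fun q : (R ⧸ Ideal.span {p ^ a}) × (R ⧸ Ideal.span {p ^ b}) =>
      Ideal.Quotient.mk (Ideal.span {p ^ (a + b)}) (q.1.out + p ^ a * q.2.out) := by
  constructor
  · rintro ⟨u, v⟩ ⟨u', v'⟩ h
    simp only [Ideal.Quotient.eq, Ideal.mem_span_singleton] at h
    obtain ⟨w, hw⟩ := h
    have hu : u = u' := by
      rw [← mk_out u, ← mk_out u', Ideal.Quotient.eq, Ideal.mem_span_singleton]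
      exact ⟨p ^ b * w - (v.out - v'.out), by linear_combination hw + w * pow_add p a b⟩
    subst hu
    have hv : v = v' := by
      rw [← mk_out v, ← mk_out v', Ideal.Quotient.eq, Ideal.mem_span_singleton]
      exact ⟨w, mul_left_cancel₀ (pow_ne_zero a hp)
        (by linear_combination hw + w * pow_add p a b)⟩
    rw [hv]
  · intro x
    obtain ⟨x, rfl⟩ := Ideal.Quotient.mk_surjective x
    have h1 := mk_out (Ideal.Quotient.mk (Ideal.span {p ^ a}) x)
    rw [Ideal.Quotient.eq, Ideal.mem_span_singleton] at h1
    obtain ⟨y, hy⟩ := h1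
    have h2 := mk_out (Ideal.Quotient.mk (Ideal.span {p ^ b}) (-y))
    rw [Ideal.Quotient.eq, Ideal.mem_span_singleton] at h2
    obtain ⟨w, hw⟩ := h2
    refine ⟨(Ideal.Quotient.mk _ x, Ideal.Quotient.mk _ (-y)), ?_⟩
    simp only [Ideal.Quotient.eq, Ideal.mem_span_singleton]
    exact ⟨w, by linear_combination hy + p ^ a * hw - w * pow_add p a b⟩

end Periodic

section Mean

variable {R : Type*} [CommRing R] (p : R) [hfin : ∀ n : ℕ, Finite (R ⧸ Ideal.span {p ^ n})]
  {V : Type*} [AddCommGroup V] [Module ℝ V]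

instance quotientFintype (n : ℕ) : Fintype (R ⧸ Ideal.span {p ^ n}) := Fintype.ofFinite _

/-- The cardinality of `R / pⁿ`. -/
def level (n : ℕ) : ℕ := Fintype.card (R ⧸ Ideal.span {p ^ n})

/-- The average of `f` over representatives of `R / pⁿ`. -/
def mean (n : ℕ) (f : R → V) : V :=
  ((level p n : ℝ)⁻¹) • ∑ u : R ⧸ Ideal.span {p ^ n}, f u.out

lemma level_pos (n : ℕ) : 0 < level p n := Fintype.card_pos

lemma mean_const (n : ℕ) (a : V) : mean p n (fun _ => a) = a := by
  have : (level p n : ℝ) ≠ 0 := by exact_mod_cast (level_pos p n).ne'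
  rw [mean, Finset.sum_const, Finset.card_univ, ← Nat.cast_smul_eq_nsmul ℝ, smul_smul,
    ← level, inv_mul_cancel₀ this, one_smul]

lemma mean_comm (m n : ℕ) (f : R → R → V) :
    mean p m (fun x => mean p n (fun y => f x y)) =
      mean p n (fun y => mean p m (fun x => f x y)) := by
  simp only [mean, ← Finset.smul_sum]
  rw [Finset.sum_comm, smul_comm]

lemma mean_add (n : ℕ) (f g : R → V) :
    mean p n (fun x => f x + g x) = mean p n f + mean p n g := by
  simp only [mean, Finset.sum_add_distrib, smul_add]

lemma mean_mono {n : ℕ} {f g : R → ℝ} (h : ∀ x, f x ≤ g x) : mean p n f ≤ mean p n g := by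
  unfold mean
  exact smul_le_smul_of_nonneg_left (Finset.sum_le_sum fun i _ => h _) (by positivity)

lemma mean_mul_left (n : ℕ) (c : ℝ) (f : R → ℝ) :
    mean p n (fun x => c * f x) = c * mean p n f := by
  simp only [mean, smul_eq_mul, ← Finset.mul_sum]
  ring

variable {p} in
lemma mean_shift {n : ℕ} {f : R → V} (hf : Periodic p n f) (a : R) :
    mean p n (fun x => f (x + a)) = mean p n f := by
  unfold mean
  congr 1
  refine Fintype.sum_equiv (Equiv.addRight (Ideal.Quotient.mk _ a)) _ _ fun u => ?_
  apply hf.eq_of_mk_eq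
  rw [map_add, mk_out, mk_out]
  rfl

lemma level_add [IsDomain R] (hp : p ≠ 0) (a b : ℕ) :
    level p (a + b) = level p a * level p b := by
  rw [level, level, level, ← Fintype.card_prod]
  exact (Fintype.card_of_bijective (digit_bijective hp a b)).symm

lemma level_mono [IsDomain R] (hp : p ≠ 0) {a b : ℕ} (h : a ≤ b) : level p a ≤ level p b := by
  obtain ⟨c, rfl⟩ := Nat.exists_eq_add_of_le h
  rw [level_add p hp]
  exact Nat.le_mul_of_pos_right _ (level_pos p c)

-- Splitting off the lowest `a` digits of the variable: this is the radix decomposition behind the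
-- fast Fourier transform.
variable {p} in
lemma mean_split [IsDomain R] (hp : p ≠ 0) {a b n : ℕ} (hn : n = a + b) {f : R → V}
    (hf : Periodic p n f) :
    mean p n f = mean p a (fun u => mean p b (fun v => f (u + p ^ a * v))) := by
  subst hn
  simp only [mean, ← Finset.smul_sum]
  rw [smul_smul, level_add p hp, Nat.cast_mul, mul_inv, ← Fintype.sum_prod_type']
  congr 1
  refine (Fintype.sum_bijective _ (digit_bijective hp a b) _ _ fun q => ?_).symm
  apply hf.eq_of_mk_eq
  rw [mk_out]

end Mean

section NormedMean

variable {R : Type*} [CommRing R] (p : R) [hfin : ∀ n : ℕ, Finite (R ⧸ Ideal.span {p ^ n})]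
  {E : Type*} [NormedAddCommGroup E] [NormedSpace ℂ E]

lemma mean_smul (n : ℕ) (z : ℂ) (f : R → E) : mean p n (fun x => z • f x) = z • mean p n f := by
  simp only [mean, ← Finset.smul_sum]
  rw [smul_comm]

lemma map_mean (n : ℕ) (L : StrongDual ℂ E) (f : R → E) :
    L (mean p n f) = mean p n (fun x => L (f x)) := by
  simp only [mean, ← Complex.coe_smul, map_smul, map_sum]

lemma norm_mean_le (n : ℕ) (f : R → E) : ‖mean p n f‖ ≤ mean p n (fun x => ‖f x‖) := by
  rw [mean, mean, norm_smul, smul_eq_mul, Real.norm_of_nonneg (by positivity)]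
  gcongr
  exact norm_sum_le _ _

lemma sq_mean_le (n : ℕ) (f : R → ℝ) : mean p n f ^ 2 ≤ mean p n (fun x => f x ^ 2) := by
  have h0 : (0 : ℝ) < level p n := by exact_mod_cast level_pos p n
  have h := sq_sum_le_card_mul_sum_sq (s := (Finset.univ : Finset (R ⧸ Ideal.span {p ^ n})))
    (f := fun u => f u.out)
  rw [Finset.card_univ, ← level] at h
  simp only [mean, smul_eq_mul, mul_pow]
  calc _ ≤ ((level p n : ℝ)⁻¹) ^ 2 * (level p n * ∑ u : R ⧸ Ideal.span {p ^ n}, f u.out ^ 2) := by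
        gcongr
    _ = _ := by field_simp

lemma norm_mean_sq_le (n : ℕ) (f : R → E) :
    ‖mean p n f‖ ^ 2 ≤ mean p n (fun x => ‖f x‖ ^ 2) :=
  (pow_le_pow_left₀ (norm_nonneg _) (norm_mean_le p n f) 2).trans (sq_mean_le p n _)

end NormedMean

/-! ### The norm of the vector-valued Fourier transform. -/

section AvgNorm

variable {E : Type*} [NormedAddCommGroup E] {I : Type*} [Fintype I]

lemma avgNorm_nonneg (f : I → E) : 0 ≤ avgNorm f := Real.sqrt_nonneg _

lemma avgNorm_sq (f : I → E) :
    avgNorm f ^ 2 = (∑ x, ‖f x‖ ^ 2) / Fintype.card I := Real.sq_sqrt (by positivity)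

lemma avgNorm_le_of_forall_le (f : I → E) {c : ℝ} (hc : 0 ≤ c)
    (h : ∀ x, ‖f x‖ ≤ c) : avgNorm f ≤ c := by
  refine Real.sqrt_le_iff.2 ⟨hc, div_le_of_le_mul₀ (by positivity) (by positivity) ?_⟩
  calc _ ≤ ∑ _x : I, c ^ 2 := by gcongr; exact h _
    _ = _ := by rw [Finset.sum_const, Finset.card_univ, nsmul_eq_mul, mul_comm]

end AvgNorm

section TransformNorm

variable (G E : Type*) [AddCommGroup G] [Finite G] [NormedAddCommGroup E] [NormedSpace ℂ E]

/-- Cauchy–Schwarz, with characters of modulus one. It makes `1` an admissible constant, so that the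
infimum defining `transformNorm` is over a nonempty set. -/
lemma norm_transform_le [Fintype G] (f : G → E) (χ : AddChar G ℂ) :
    ‖transform f χ‖ ≤ avgNorm f := by
  have hcard : (0 : ℝ) < Fintype.card G := by exact_mod_cast Fintype.card_pos
  refine Real.le_sqrt_of_sq_le ?_
  have h1 : ‖transform f χ‖ ≤ (Fintype.card G : ℝ)⁻¹ * ∑ x, ‖f x‖ := by
    rw [transform, norm_smul, Subsingleton.elim (Fintype.ofFinite G) ‹Fintype G›]
    simp only [norm_inv, Complex.norm_natCast]
    gcongr
    refine (norm_sum_le _ _).trans (Finset.sum_le_sum fun x _ => ?_)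
    rw [norm_smul, AddChar.norm_apply, one_mul]
  have h2 := sq_sum_le_card_mul_sum_sq (s := (Finset.univ : Finset G)) (f := fun x => ‖f x‖)
  rw [Finset.card_univ] at h2
  calc _ ≤ ((Fintype.card G : ℝ)⁻¹ * ∑ x, ‖f x‖) ^ 2 := by gcongr
    _ ≤ ((Fintype.card G : ℝ)⁻¹) ^ 2 * (Fintype.card G * ∑ x, ‖f x‖ ^ 2) := by
        rw [mul_pow]; gcongr
    _ = _ := by field_simp

lemma avgNorm_transform_le [Fintype G] {c : ℝ} (hc : transformNorm G E ≤ c) (f : G → E) :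
    avgNorm (transform f) ≤ c * avgNorm f := by
  suffices h : avgNorm (transform f) ≤ transformNorm G E * avgNorm f from
    h.trans (mul_le_mul_of_nonneg_right hc (avgNorm_nonneg f))
  rw [transformNorm, Subsingleton.elim (Fintype.ofFinite G) ‹Fintype G›]
  rcases (avgNorm_nonneg f).eq_or_lt with h0 | h0
  · rw [← h0, mul_zero]
    refine avgNorm_le_of_forall_le _ le_rfl fun χ => ?_
    rw [h0]
    exact norm_transform_le G E f χ
  · rw [← div_le_iff₀ h0]
    refine le_csInf ⟨1, zero_le_one, fun g => ?_⟩ fun b hb => ?_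
    · rw [one_mul]
      exact avgNorm_le_of_forall_le _ (avgNorm_nonneg g) (norm_transform_le G E g)
    · rw [div_le_iff₀ h0]
      exact hb.2 f

end TransformNorm

end FiniteFourier

end

noncomputable section

namespace FiniteFourier

/-! ### Primitive characters and the discrete Radon transform. -/

section Radon

variable {R : Type*} [CommRing R] {p : R}

/-- The additive character `χ` is trivial on `pⁿ R` and non-trivial on `pⁿ⁻¹ R`. -/
structure IsPrimitive (p : R) (χ : AddChar R ℂ) (n : ℕ) : Prop where
  eq_one (w : R) : χ (p ^ n * w) = 1
  exists_ne_one : ∃ w, χ (p ^ (n - 1) * w) ≠ 1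

lemma IsPrimitive.mulShift {χ : AddChar R ℂ} {m n : ℕ} (hχ : IsPrimitive p χ (m + n))
    (hn : 1 ≤ n) : IsPrimitive p (χ.mulShift (p ^ m)) n := by
  refine ⟨fun w => ?_, ?_⟩
  · rw [AddChar.mulShift_apply, ← mul_assoc, ← pow_add, hχ.eq_one]
  · obtain ⟨w, hw⟩ := hχ.exists_ne_one
    refine ⟨w, ?_⟩
    rwa [AddChar.mulShift_apply, ← mul_assoc, ← pow_add, ← Nat.add_sub_assoc hn]

/-- A nonzero `x` of valuation `k < n` has multiples filling `p^k R`, which contains `p^(n-1) R`,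
where `χ` is not trivial. This is the nondegeneracy of the pairing `χ (x y)` on `R / pⁿ`. -/
lemma IsPrimitive.dvd [IsDomain R] [IsDiscreteValuationRing R] {χ : AddChar R ℂ} {n : ℕ} (hp : Irreducible p) (hχ : IsPrimitive p χ n)
    {x : R} (hx : ∀ y, χ (x * y) = 1) : p ^ n ∣ x := by
  by_cases h0 : x = 0
  · simp [h0]
  obtain ⟨k, u, rfl⟩ := IsDiscreteValuationRing.eq_unit_mul_pow_irreducible h0 hp
  rcases le_or_gt n k with h | h
  · exact Dvd.dvd.mul_left (pow_dvd_pow p h) _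
  · exfalso
    obtain ⟨w, hw⟩ := hχ.exists_ne_one
    apply hw
    rw [← hx (((u⁻¹ : Rˣ) : R) * (p ^ (n - 1 - k) * w))]
    congr 1
    have : p ^ (n - 1) = p ^ k * p ^ (n - 1 - k) := by rw [← pow_add]; congr 1; omega
    rw [this]
    linear_combination -(p ^ k * p ^ (n - 1 - k) * w) * u.mul_inv

/-- The character `y ↦ χ (x y)` of `R / pⁿ`, for `χ` trivial on `pⁿ R`. -/
def dualChar (p : R) (χ : AddChar R ℂ) (n : ℕ) (hχ : ∀ w, χ (p ^ n * w) = 1) (x : R) :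
    AddChar (R ⧸ Ideal.span {p ^ n}) ℂ :=
  have hper : Periodic p n (fun y => χ (x * y)) := fun y w => by
    simp only [mul_add, AddChar.map_add_eq_mul, mul_left_comm x, hχ, mul_one]
  { toFun := fun u => χ (x * u.out)
    map_zero_eq_one' := by
      have := hper.eq_of_mk_eq (x := (0 : R ⧸ Ideal.span {p ^ n}).out) (y := 0)
        (by rw [mk_out, map_zero])
      simpa using this
    map_add_eq_mul' := fun a b => by
      have := hper.eq_of_mk_eq (x := (a + b).out) (y := a.out + b.out)
        (by rw [map_add, mk_out, mk_out, mk_out])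
      rw [← AddChar.map_add_eq_mul, ← mul_add]
      exact this }

lemma dualChar_apply (χ : AddChar R ℂ) (n : ℕ) (hχ : ∀ w, χ (p ^ n * w) = 1) (x : R)
    (u : R ⧸ Ideal.span {p ^ n}) : dualChar p χ n hχ x u = χ (x * u.out) := rfl

variable [hfin : ∀ n : ℕ, Finite (R ⧸ Ideal.span {p ^ n})]
  {E : Type*} [NormedAddCommGroup E]

lemma mean_norm_sq_eq_avgNorm (n : ℕ) (g : R → E) :
    mean p n (fun x => ‖g x‖ ^ 2) =
      avgNorm (fun u : R ⧸ Ideal.span {p ^ n} => g u.out) ^ 2 := by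
  rw [avgNorm_sq, mean, smul_eq_mul, level]
  ring

variable [NormedSpace ℂ E]

/-- The trivial bound for the discrete Radon transform `ζ ↦ 𝔼_y ζ(y, t + x y)`. -/
lemma mean_radon_le_self (n : ℕ) (ζ : R → R → E) (hz : ∀ y, Periodic p n (ζ y)) :
    mean p n (fun x => mean p n fun t => ‖mean p n fun y => ζ y (t + x * y)‖ ^ 2) ≤
      mean p n fun y => mean p n fun z => ‖ζ y z‖ ^ 2 := by
  calc _ ≤ mean p n (fun x => mean p n fun t => mean p n fun y => ‖ζ y (t + x * y)‖ ^ 2) :=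
        mean_mono p fun x => mean_mono p fun t => norm_mean_sq_le p n _
    _ = mean p n (fun _ => mean p n fun y => mean p n fun z => ‖ζ y z‖ ^ 2) := by
        congr 1
        ext x
        rw [mean_comm]
        congr 1
        ext y
        exact mean_shift (f := fun z => ‖ζ y z‖ ^ 2) (fun z w => by simp only [hz y z w]) (x * y)
    _ = _ := mean_const p n _

lemma IsPrimitive.norm_eq_one {χ : AddChar R ℂ} {n : ℕ} (hχ : IsPrimitive p χ n) (x : R) :
    ‖χ x‖ = 1 := by
  have h : χ (1 * x) = dualChar p χ n hχ.eq_one 1 (Ideal.Quotient.mk _ x) := by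
    rw [dualChar_apply]
    exact (Periodic.eq_of_mk_eq (f := fun y => χ (1 * y)) (fun y w => by
      simp only [one_mul, AddChar.map_add_eq_mul, hχ.eq_one, mul_one]) (mk_out _)).symm
  rw [← one_mul x, h, AddChar.norm_apply]

variable [IsDomain R] [IsDiscreteValuationRing R]

/-- Self-duality of `R / pⁿ`: nondegeneracy gives injectivity, and a finite abelian group and its
dual have equal cardinality. -/
lemma dualChar_bijective {χ : AddChar R ℂ} {n : ℕ} (hp : Irreducible p)
    (hχ : IsPrimitive p χ n) :
    Function.Bijective fun u : R ⧸ Ideal.span {p ^ n} => dualChar p χ n hχ.eq_one u.out := by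
  rw [Fintype.bijective_iff_injective_and_card]
  refine ⟨fun u u' h => ?_, AddChar.card_eq.symm⟩
  rw [← mk_out u, ← mk_out u', Ideal.Quotient.eq, Ideal.mem_span_singleton]
  refine hχ.dvd hp fun y => ?_
  have h1 := DFunLike.congr_fun h (Ideal.Quotient.mk _ y)
  simp only [dualChar_apply] at h1
  have hper : ∀ x, Periodic p n (fun y => χ (x * y)) := fun x y w => by
    simp only [mul_add, AddChar.map_add_eq_mul, mul_left_comm x, hχ.eq_one, mul_one]
  have h2 := fun x => (hper x).eq_of_mk_eq (mk_out (Ideal.Quotient.mk (Ideal.span {p ^ n}) y))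
  rw [h2, h2] at h1
  rw [sub_mul, AddChar.map_sub_eq_div, h1, div_self fun h0 => by simpa [h0] using hχ.norm_eq_one (u'.out * y)]

lemma mean_fourier_le {χ : AddChar R ℂ} {n : ℕ} (hp : Irreducible p) (hχ : IsPrimitive p χ n)
    {c : ℝ} (hc : transformNorm (R ⧸ Ideal.span {p ^ n}) E ≤ c) (g : R → E) :
    mean p n (fun x => ‖mean p n (fun y => χ (x * y) • g y)‖ ^ 2) ≤
      c ^ 2 * mean p n (fun y => ‖g y‖ ^ 2) := by
  set f : R ⧸ Ideal.span {p ^ n} → E := fun u => g u.out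
  have key : mean p n (fun x => ‖mean p n (fun y => χ (x * y) • g y)‖ ^ 2) =
      avgNorm (transform f) ^ 2 := by
    rw [avgNorm_sq, mean, smul_eq_mul, AddChar.card_eq, ← level, div_eq_inv_mul]
    congr 1
    refine Fintype.sum_bijective _ (dualChar_bijective hp hχ) _ _ fun u => ?_
    congr 2
    rw [mean, transform, Subsingleton.elim (Fintype.ofFinite _) (quotientFintype p n), ← level,
      ← Complex.coe_smul]
    push_cast
    rfl
  rw [key, mean_norm_sq_eq_avgNorm, ← mul_pow]
  exact pow_le_pow_left₀ (avgNorm_nonneg _) (avgNorm_transform_le _ _ hc f) 2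

/-- The fast Fourier bound for the discrete Radon transform `ζ ↦ 𝔼_y ζ(y, t + x y)`, on functions
that transform under `p^(n-h) R` by a primitive character. -/
theorem mean_radon_le (hp : Irreducible p) {h : ℕ} (hh : 1 ≤ h) {c : ℝ}
    (hc : transformNorm (R ⧸ Ideal.span {p ^ h}) E ≤ c) (n : ℕ) :
    ∀ (ψ : AddChar R ℂ) (ζ : R → R → E), Periodic p n ζ → (∀ y, Periodic p n (ζ y)) →
      (h ≤ n → IsPrimitive p ψ n ∧
        ∀ y z w, ζ y (z + p ^ (n - h) * w) = ψ (p ^ (n - h) * w) • ζ y z) →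
      mean p n (fun x => mean p n fun t => ‖mean p n fun y => ζ y (t + x * y)‖ ^ 2) ≤
        (c ^ (n / h)) ^ 2 * mean p n fun y => mean p n fun z => ‖ζ y z‖ ^ 2 := by
  induction n using Nat.strong_induction_on with
  | _ n ih =>
  intro ψ ζ hy hz hψ
  rcases lt_or_ge n h with hn | hn
  -- Fewer than `h` digits remain: no gain is claimed, and the trivial bound suffices.
  · rw [Nat.div_eq_of_lt hn, pow_zero, one_pow, one_mul]
    exact mean_radon_le_self n ζ hz
  obtain ⟨hprim, hequiv⟩ := hψ hn
  obtain ⟨m, rfl⟩ := Nat.exists_eq_add_of_le' hn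
  rw [Nat.add_sub_cancel] at hequiv
  have hp0 := hp.ne_zero
  have hmod : ∀ w, ψ (p ^ (m + h) * w) = 1 := hprim.eq_one
  have hy' : ∀ y w z, ζ (y + p ^ (m + h) * w) z = ζ y z := fun y w z => congrFun (hy y w) z
  have hz' : ∀ y z w, ζ y (z + p ^ (m + h) * w) = ζ y z := fun y z w => hz y z w
  -- Average over the top `h` digits `v` of `y + p^m v`. By equivariance the shift of `z` by `p^m x
  -- v` becomes the scalar `ψ (p^m x v)`, so this is a Fourier transform in `v` with dual variable
  -- `x`.
  set ζ₁ : R → R → R → E := fun y x z =>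
    mean p h fun v => ψ (p ^ m * (x * v)) • ζ (y + p ^ m * v) z with hζ₁
  have hζ₁z : ∀ y x, Periodic p (m + h) (ζ₁ y x) := fun y x z w => by
    simp only [hζ₁, hz _ z w]
  have hζ₁e : ∀ y x z w, ζ₁ y x (z + p ^ m * w) = ψ (p ^ m * w) • ζ₁ y x z := fun y x z w => by
    simp only [hζ₁, hequiv]
    rw [← mean_smul]
    congr 1
    ext v
    rw [smul_comm]
  -- Periodicity in `y` modulo `p^m` holds only along a shear: translating `v` by `w` produces a
  -- character value, which the shift of `z` cancels.
  have hζ₁y : ∀ y x z w, ζ₁ (y + p ^ m * w) x (z + x * (p ^ m * w)) = ζ₁ y x z := by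
    intro y x z w
    have hper : Periodic p h fun v => ψ (p ^ m * (x * v)) • ζ (y + p ^ m * v) z := by
      intro v w
      have e1 : p ^ m * (x * (v + p ^ h * w)) = p ^ m * (x * v) + p ^ (m + h) * (x * w) := by ring
      have e2 : y + p ^ m * (v + p ^ h * w) = y + p ^ m * v + p ^ (m + h) * w := by ring
      simp only [e1, e2, AddChar.map_add_eq_mul, hmod, mul_one, hy']
    simp only [hζ₁]
    rw [← mean_shift hper w]
    congr 1
    ext v
    have e1 : z + x * (p ^ m * w) = z + p ^ m * (x * w) := by ring
    have e2 : p ^ m * (x * (v + w)) = p ^ m * (x * v) + p ^ m * (x * w) := by ring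
    have e3 : y + p ^ m * (v + w) = y + p ^ m * w + p ^ m * v := by ring
    rw [e1, e2, e3, hequiv, smul_smul, AddChar.map_add_eq_mul]
  -- The shear by `x₀ y` restores genuine periodicity in `y`; with `x₀` and `t₀` fixed, what remains
  -- is a Radon transform at level `m`, for the character `ψ (p^h ·)`.
  set ζ₂ : R → R → R → R → E := fun x₀ t₀ y z => ζ₁ y x₀ (t₀ + p ^ h * z + x₀ * y) with hζ₂
  -- one radix step
  have hstep : ∀ x₀ x' t₀ t', mean p (m + h)
      (fun y => ζ y (t₀ + p ^ h * t' + (x₀ + p ^ h * x') * y)) =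
        mean p m fun y => ζ₂ x₀ t₀ y (t' + x' * y) := by
    intro x₀ x' t₀ t'
    rw [mean_split hp0 rfl]
    · simp only [hζ₂, hζ₁]
      congr 1
      ext y
      congr 1
      ext v
      have e : t₀ + p ^ h * t' + (x₀ + p ^ h * x') * (y + p ^ m * v) =
          t₀ + p ^ h * (t' + x' * y) + x₀ * y + p ^ m * (x₀ * v + p ^ h * (x' * v)) := by ring
      have e2 : p ^ m * (x₀ * v + p ^ h * (x' * v)) =
          p ^ m * (x₀ * v) + p ^ (m + h) * (x' * v) := by ring
      rw [e, hequiv, e2, AddChar.map_add_eq_mul, hmod, mul_one]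
    · intro y w
      have e : t₀ + p ^ h * t' + (x₀ + p ^ h * x') * (y + p ^ (m + h) * w) =
          t₀ + p ^ h * t' + (x₀ + p ^ h * x') * y
            + p ^ (m + h) * ((x₀ + p ^ h * x') * w) := by ring
      simp only [e, hz _ _ _, hy']
  have hind : ∀ x₀ t₀, mean p m (fun x' => mean p m fun t' =>
      ‖mean p m fun y => ζ₂ x₀ t₀ y (t' + x' * y)‖ ^ 2) ≤
      (c ^ (m / h)) ^ 2 * mean p m fun y => mean p m fun z => ‖ζ₂ x₀ t₀ y z‖ ^ 2 := by
    intro x₀ t₀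
    refine ih m (by omega) (ψ.mulShift (p ^ h)) _ ?_ ?_ ?_
    · intro y w
      ext z
      simp only [hζ₂]
      rw [← hζ₁y y x₀ _ w]
      congr 1
      ring
    · intro y z w
      simp only [hζ₂]
      rw [← hζ₁z y x₀ (t₀ + p ^ h * z + x₀ * y) w]
      congr 1
      ring
    · intro hm
      refine ⟨IsPrimitive.mulShift (by rwa [add_comm]) (hh.trans hm), fun y z w => ?_⟩
      have e : p ^ m = p ^ h * p ^ (m - h) := by rw [← pow_add]; congr 1; omega
      have e1 : t₀ + p ^ h * (z + p ^ (m - h) * w) + x₀ * y =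
          t₀ + p ^ h * z + x₀ * y + p ^ m * w := by rw [e]; ring
      simp only [hζ₂]
      rw [e1, hζ₁e, AddChar.mulShift_apply, ← mul_assoc, ← e]
  have hprim' : IsPrimitive p (ψ.mulShift (p ^ m)) h := hprim.mulShift hh
  calc mean p (m + h) (fun x => mean p (m + h) fun t =>
          ‖mean p (m + h) fun y => ζ y (t + x * y)‖ ^ 2)
      = mean p h (fun x₀ => mean p h fun t₀ => mean p m fun x' => mean p m fun t' =>
          ‖mean p m fun y => ζ₂ x₀ t₀ y (t' + x' * y)‖ ^ 2) := by
        rw [mean_split hp0 (add_comm m h)]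
        · congr 1
          ext x₀
          have : ∀ x', mean p (m + h) (fun t =>
              ‖mean p (m + h) fun y => ζ y (t + (x₀ + p ^ h * x') * y)‖ ^ 2) =
              mean p h fun t₀ => mean p m fun t' =>
                ‖mean p m fun y => ζ₂ x₀ t₀ y (t' + x' * y)‖ ^ 2 := by
            intro x'
            rw [mean_split hp0 (add_comm m h)]
            · simp only [hstep]
            · intro t w
              have e : ∀ y, t + p ^ (m + h) * w + (x₀ + p ^ h * x') * y =
                t + (x₀ + p ^ h * x') * y + p ^ (m + h) * w := fun y => by ring
              simp only [e, hz']
          simp only [this]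
          rw [mean_comm]
        · intro x w
          have e : ∀ t y, t + (x + p ^ (m + h) * w) * y =
            t + x * y + p ^ (m + h) * (w * y) := fun t y => by ring
          simp only [e, hz _ _ _]
    _ ≤ mean p h (fun x₀ => mean p h fun t₀ =>
          (c ^ (m / h)) ^ 2 * mean p m fun y => mean p m fun z => ‖ζ₂ x₀ t₀ y z‖ ^ 2) :=
        mean_mono p fun x₀ => mean_mono p fun t₀ => hind x₀ t₀
    _ = (c ^ (m / h)) ^ 2 * mean p h (fun x₀ => mean p m fun y =>
          mean p (m + h) fun z => ‖ζ₁ y x₀ z‖ ^ 2) := by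
        simp only [mean_mul_left]
        congr 2
        ext x₀
        rw [mean_comm]
        congr 1
        ext y
        have hper : Periodic p (m + h) fun z => ‖ζ₁ y x₀ z‖ ^ 2 := fun z w => by
          simp only [hζ₁z y x₀ z w]
        have hper' : Periodic p (m + h) fun z => ‖ζ₁ y x₀ (z + x₀ * y)‖ ^ 2 := fun z w => by
          simp only [add_right_comm z, hζ₁z y x₀ _ w]
        rw [← mean_shift hper (x₀ * y), mean_split hp0 (add_comm m h) hper']
    _ = (c ^ (m / h)) ^ 2 * mean p m (fun y => mean p (m + h) fun z =>
          mean p h fun x₀ => ‖ζ₁ y x₀ z‖ ^ 2) := by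
        rw [mean_comm]
        congr 2
        ext y
        rw [mean_comm]
    -- The one factor `c` gained per block: Fourier transform on `R / p^h` between `v` and the low
    -- digits `x₀` of `x`.
    _ ≤ (c ^ (m / h)) ^ 2 * mean p m (fun y => mean p (m + h) fun z =>
          c ^ 2 * mean p h fun v => ‖ζ (y + p ^ m * v) z‖ ^ 2) := by
        refine mul_le_mul_of_nonneg_left (mean_mono p fun y => mean_mono p fun z => ?_)
          (by positivity)
        exact mean_fourier_le hp hprim' hc fun v => ζ (y + p ^ m * v) z
    _ = (c ^ ((m + h) / h)) ^ 2 * mean p (m + h) fun y => mean p (m + h) fun z =>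
          ‖ζ y z‖ ^ 2 := by
        rw [Nat.add_div_right _ (by omega)]
        simp only [mean_mul_left]
        rw [mean_split hp0 rfl (f := fun y => mean p (m + h) fun z => ‖ζ y z‖ ^ 2)
          (fun y w => by simp only [hy'])]
        rw [← mul_assoc, ← mul_pow, ← pow_succ]
        congr 2
        ext y
        rw [mean_comm]

/-- A family of pairings that depends on `z - t - x y` only has a small jump between
`pⁿ R` and `pⁿ⁻¹ R`. -/
theorem norm_jump_le (hp : Irreducible p) {h : ℕ} (hh : 1 ≤ h) {c : ℝ} (hc0 : 0 ≤ c)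
    (hc : transformNorm (R ⧸ Ideal.span {p ^ h}) E ≤ c) {n : ℕ} (hn : 1 ≤ n)
    {ξ : R → R → E} (hy : Periodic p n ξ) (hz : ∀ y, Periodic p n (ξ y))
    {η : R → R → StrongDual ℂ E} {f : R → ℂ} (hf : ∀ x t y z, η x t (ξ y z) = f (z - t - x * y))
    {M N : ℝ} (hη : ∀ x t, ‖η x t‖ ≤ M) (hξ : ∀ y z, ‖ξ y z‖ ≤ N) {F₀ F₁ : ℂ}
    (h0 : ∀ w, f (p ^ n * w) = F₀) (h1 : ∀ w, ¬ p ∣ w → f (p ^ (n - 1) * w) = F₁)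
    (hinv : ∀ s w, ¬ p ^ (n - 1) ∣ s → f (s + p ^ (n - 1) * w) = f s) :
    ‖F₀ - F₁‖ ≤ level p h * c ^ (n / h) * (M * N) := by
  classical
  have hp0 := hp.ne_zero
  -- For `n < h` there is no subgroup `p^(n-h) R`; one then projects over all of `R`, and
  -- `mean_radon_le` asks for no equivariance.
  set k := min h n with hk
  have hkn : k ≤ n := min_le_right _ _
  -- Characters separate points of `R / pⁿ`, and `p^(n-1)` is nonzero there.
  obtain ⟨ψ, hψ⟩ : ∃ ψ : AddChar R ℂ, IsPrimitive p ψ n := by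
    obtain ⟨χ, hχ⟩ := (AddChar.exists_apply_ne_zero
      (a := Ideal.Quotient.mk (Ideal.span {p ^ n}) (p ^ (n - 1)))).2 (by
        rw [Ne, Ideal.Quotient.eq_zero_iff_mem, Ideal.mem_span_singleton]
        intro hd
        have := (pow_dvd_pow_iff hp0 hp.not_isUnit).1 hd
        omega)
    refine ⟨χ.compAddMonoidHom (Ideal.Quotient.mk (Ideal.span {p ^ n})).toAddMonoidHom,
      fun w => ?_, 1, ?_⟩
    · change χ (Ideal.Quotient.mk (Ideal.span {p ^ n}) (p ^ n * w)) = 1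
      rw [Ideal.Quotient.eq_zero_iff_mem.2 (Ideal.mem_span_singleton.2 (dvd_mul_right _ _)),
        AddChar.map_zero_eq_one]
    · rw [mul_one]
      exact hχ
  have hpk : p ^ n = p ^ (n - k) * p ^ k := by rw [← pow_add]; congr 1; omega
  set a : ℂ := (level p k : ℂ) with ha
  -- The `ψ`-component of `ξ y` under translation by `p^(n-k) R`, with a sum in place of an average;
  -- the factor `a` makes the pairing below exactly `F₀ - F₁`.
  set ζ : R → R → E := fun y z =>
    a • mean p k fun w => ψ (-(p ^ (n - k) * w)) • ξ y (z + p ^ (n - k) * w) with hζ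
  have hζy : Periodic p n ζ := fun y w => by
    simp only [hζ, hy y w]
  have hζz : ∀ y, Periodic p n (ζ y) := fun y z w => by
    simp only [hζ]
    congr 2
    ext v
    rw [add_right_comm, hz]
  have hζe : ∀ y z w, ζ y (z + p ^ (n - k) * w) = ψ (p ^ (n - k) * w) • ζ y z := by
    intro y z w
    have hper : Periodic p k fun v => ψ (-(p ^ (n - k) * v)) • ξ y (z + p ^ (n - k) * v) := by
      intro v u
      have e1 : -(p ^ (n - k) * (v + p ^ k * u)) = -(p ^ (n - k) * v) + p ^ n * (-u) := by
        rw [hpk]; ring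
      have e2 : z + p ^ (n - k) * (v + p ^ k * u) = z + p ^ (n - k) * v + p ^ n * u := by
        rw [hpk]; ring
      simp only [e1, e2, AddChar.map_add_eq_mul, hψ.eq_one, mul_one, hz _ _ _]
    simp only [hζ]
    rw [← mean_shift hper w, smul_comm _ a]
    congr 1
    rw [← mean_smul]
    congr 1
    funext v
    rw [smul_smul, ← AddChar.map_add_eq_mul]
    congr 2 <;> ring_nf
  -- the pairing with the transform of `ζ` is the jump
  have hsum : a * mean p k (fun w => ψ (-(p ^ (n - k) * w)) * f (p ^ (n - k) * w)) = F₀ - F₁ := by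
    obtain ⟨w₀, hw₀⟩ := hψ.exists_ne_one
    -- Lowering `f` by the jump on `pⁿ R` makes it invariant under `p^(n-1) R`, where `ψ` is not
    -- trivial. Its `ψ`-coefficient therefore vanishes, and only the jump survives.
    set g : R → ℂ := fun s => f s - if p ^ n ∣ s then F₀ - F₁ else 0 with hg
    have hpn : p ^ n = p ^ (n - 1) * p := by rw [← pow_succ]; congr 1; omega
    have hgF : ∀ v, g (p ^ (n - 1) * v) = F₁ := by
      intro v
      by_cases hv : p ∣ v
      · obtain ⟨v, rfl⟩ := hv
        simp only [hg]
        rw [← mul_assoc, ← hpn, h0, if_pos (dvd_mul_right _ _)]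
        ring
      · simp only [hg]
        rw [h1 v hv, if_neg, sub_zero]
        rwa [hpn, mul_dvd_mul_iff_left (pow_ne_zero _ hp0)]
    have hginv : ∀ s w, g (s + p ^ (n - 1) * w) = g s := by
      intro s w
      by_cases hs : p ^ (n - 1) ∣ s
      · obtain ⟨v, rfl⟩ := hs
        rw [← mul_add, hgF, hgF]
      · have h2 : ¬ p ^ n ∣ s := fun hd => hs ((pow_dvd_pow p (Nat.sub_le n 1)).trans hd)
        have h3 : ¬ p ^ n ∣ s + p ^ (n - 1) * w := fun hd =>
          hs ((dvd_add_left (dvd_mul_right _ _)).1 ((pow_dvd_pow p (Nat.sub_le n 1)).trans hd))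
        simp only [hg]
        rw [if_neg h2, if_neg h3, hinv s w hs]
    have hk1 : 1 ≤ k := le_min hh hn
    have hmean0 : mean p k (fun w => ψ (-(p ^ (n - k) * w)) * g (p ^ (n - k) * w)) = 0 := by
      have hper : Periodic p k fun w => ψ (-(p ^ (n - k) * w)) * g (p ^ (n - k) * w) := by
        intro v u
        have e1 : -(p ^ (n - k) * (v + p ^ k * u)) = -(p ^ (n - k) * v) + p ^ n * (-u) := by
          rw [hpk]; ring
        have e2 : p ^ (n - k) * (v + p ^ k * u) = p ^ (n - k) * v + p ^ (n - 1) * (p * u) := by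
          rw [← mul_assoc (p ^ (n - 1)), ← hpn, hpk]; ring
        simp only [e1]
        rw [e2, AddChar.map_add_eq_mul, hψ.eq_one, mul_one, hginv]
      have hsh := mean_shift hper (-(p ^ (k - 1) * w₀))
      have e : ∀ v, ψ (-(p ^ (n - k) * (v + -(p ^ (k - 1) * w₀)))) *
          g (p ^ (n - k) * (v + -(p ^ (k - 1) * w₀))) =
          ψ (p ^ (n - 1) * w₀) • (ψ (-(p ^ (n - k) * v)) * g (p ^ (n - k) * v)) := by
        intro v
        have hpk' : p ^ (n - 1) = p ^ (n - k) * p ^ (k - 1) := by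
          rw [← pow_add]; congr 1; omega
        have e1 : p ^ (n - k) * (v + -(p ^ (k - 1) * w₀)) =
            p ^ (n - k) * v + p ^ (n - 1) * (-w₀) := by rw [hpk']; ring
        have e2 : -(p ^ (n - k) * v + p ^ (n - 1) * (-w₀)) =
            p ^ (n - 1) * w₀ + -(p ^ (n - k) * v) := by ring
        rw [e1, hginv, e2, AddChar.map_add_eq_mul, smul_eq_mul, mul_assoc]
      simp only [e] at hsh
      rw [mean_smul, smul_eq_mul] at hsh
      exact (mul_left_eq_self₀.1 hsh).resolve_left hw₀
    have hsplit : ∀ w, ψ (-(p ^ (n - k) * w)) * f (p ^ (n - k) * w) =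
        ψ (-(p ^ (n - k) * w)) * g (p ^ (n - k) * w) + if p ^ k ∣ w then F₀ - F₁ else 0 := by
      intro w
      have hiff : p ^ n ∣ p ^ (n - k) * w ↔ p ^ k ∣ w := by
        rw [hpk, mul_dvd_mul_iff_left (pow_ne_zero _ hp0)]
      simp only [hg, hiff]
      split_ifs with hw
      · obtain ⟨v, rfl⟩ := hw
        have : ψ (-(p ^ (n - k) * (p ^ k * v))) = 1 := by
          rw [← mul_assoc, ← hpk, ← mul_neg, hψ.eq_one]
        rw [this]
        ring
      · ring
    have ha0 : (level p k : ℝ) ≠ 0 := by exact_mod_cast (level_pos p k).ne'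
    have hind : mean p k (fun w => if p ^ k ∣ w then F₀ - F₁ else 0) =
        ((level p k : ℝ)⁻¹) • (F₀ - F₁) := by
      rw [mean]
      congr 1
      rw [Finset.sum_eq_single 0]
      · rw [if_pos]
        rw [← Ideal.mem_span_singleton, ← Ideal.Quotient.eq_zero_iff_mem, mk_out]
      · intro u _ hu
        rw [if_neg]
        rw [← Ideal.mem_span_singleton, ← Ideal.Quotient.eq_zero_iff_mem, mk_out]
        exact hu
      · simp
    simp only [hsplit]
    rw [mean_add, hmean0, hind, zero_add, ← Complex.coe_smul, smul_eq_mul, ha]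
    push_cast
    have : (level p k : ℂ) ≠ 0 := by exact_mod_cast (level_pos p k).ne'
    field_simp
  -- The pairing is the same for all `x` and `t`, so a mean-square bound over `x, t` controls this
  -- single number.
  have hpair : ∀ x t, F₀ - F₁ = η x t (mean p n fun y => ζ y (t + x * y)) := by
    intro x t
    have : ∀ y, η x t (ζ y (t + x * y)) = F₀ - F₁ := by
      intro y
      have e : ∀ w, t + x * y + p ^ (n - k) * w - t - x * y = p ^ (n - k) * w := fun w => by ring
      simp only [hζ, map_smul, map_mean, hf, e, smul_eq_mul]
      exact hsum
    rw [map_mean]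
    simp only [this, mean_const]
  have hζN : ∀ y z, ‖ζ y z‖ ≤ level p h * N := by
    intro y z
    have h1 : ‖mean p k fun w => ψ (-(p ^ (n - k) * w)) • ξ y (z + p ^ (n - k) * w)‖ ≤ N := by
      rw [← mean_const p k N]
      refine (norm_mean_le p k _).trans (mean_mono p fun w => ?_)
      have hψ1 : ‖ψ (-(p ^ (n - k) * w))‖ = 1 :=
        hψ.norm_eq_one _
      rw [norm_smul, hψ1, one_mul]
      exact hξ _ _
    rw [hζ, norm_smul, ha, Complex.norm_natCast]
    have h2 : (level p k : ℝ) ≤ level p h := by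
      exact_mod_cast level_mono p hp0 (min_le_left h n)
    exact mul_le_mul h2 h1 (norm_nonneg _) (by positivity)
  have hM : 0 ≤ M := (norm_nonneg _).trans (hη 0 0)
  have hN : 0 ≤ N := (norm_nonneg _).trans (hξ 0 0)
  have hsq : ‖F₀ - F₁‖ ^ 2 ≤ (level p h * c ^ (n / h) * (M * N)) ^ 2 := by
    calc ‖F₀ - F₁‖ ^ 2 = mean p n (fun x => mean p n fun t => ‖F₀ - F₁‖ ^ 2) := by
          simp only [mean_const]
      _ ≤ mean p n (fun x => mean p n fun t =>
            M ^ 2 * ‖mean p n fun y => ζ y (t + x * y)‖ ^ 2) := by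
          refine mean_mono p fun x => mean_mono p fun t => ?_
          rw [hpair x t, ← mul_pow]
          refine pow_le_pow_left₀ (norm_nonneg _) ?_ 2
          exact (ContinuousLinearMap.le_opNorm _ _).trans
            (mul_le_mul_of_nonneg_right (hη x t) (norm_nonneg _))
      _ = M ^ 2 * mean p n (fun x => mean p n fun t =>
            ‖mean p n fun y => ζ y (t + x * y)‖ ^ 2) := by
          simp only [mean_mul_left]
      _ ≤ M ^ 2 * ((c ^ (n / h)) ^ 2 * mean p n fun y => mean p n fun z => ‖ζ y z‖ ^ 2) := by
          refine mul_le_mul_of_nonneg_left (mean_radon_le hp hh hc n ψ ζ hζy hζz fun hle => ?_)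
            (by positivity)
          rw [min_eq_left hle] at hk
          rw [← hk]
          exact ⟨hψ, hζe⟩
      _ ≤ M ^ 2 * ((c ^ (n / h)) ^ 2 * mean p n fun y => mean p n fun z =>
            (level p h * N) ^ 2) := by
          refine mul_le_mul_of_nonneg_left (mul_le_mul_of_nonneg_left
            (mean_mono p fun y => mean_mono p fun z => ?_) (by positivity)) (by positivity)
          exact pow_le_pow_left₀ (norm_nonneg _) (hζN y z) 2
      _ = _ := by
          simp only [mean_const]
          ring
  exact (pow_le_pow_iff_left₀ (norm_nonneg _) (by positivity) two_ne_zero).1 hsq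

end Radon

end FiniteFourier

end

noncomputable section

namespace LocalSL3

/-! ### Double cosets of corner and diagonal matrices. -/

section MatrixIdentities

variable {R : Type*} [CommRing R]

/-- The matrix `[[pᵇ, 0, s], [0, pᶜ, 0], [0, 0, pᵃ]]`. -/
def cornerMatrix (p : R) (a b c : ℕ) (s : R) : Matrix (Fin 3) (Fin 3) R :=
  !![p ^ b, 0, s; 0, p ^ c, 0; 0, 0, p ^ a]

/-- The matrix `diag(pᵃ, pᵇ, pᶜ)`. -/
def diagPow (p : R) (a b c : ℕ) : Matrix (Fin 3) (Fin 3) R :=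
  !![p ^ a, 0, 0; 0, p ^ b, 0; 0, 0, p ^ c]

/-- `A` lies in the double coset of `B` under `SL₃(R)`, up to a power of `p`. -/
def SameCoset (p : R) (A B : Matrix (Fin 3) (Fin 3) R) : Prop :=
  ∃ U V : Matrix (Fin 3) (Fin 3) R, U.det = 1 ∧ V.det = 1 ∧ ∃ k : ℕ, A = p ^ k • (U * B * V)

lemma SameCoset.refl (p : R) (A : Matrix (Fin 3) (Fin 3) R) : SameCoset p A A :=
  ⟨1, 1, by simp, by simp, 0, by simp⟩

lemma SameCoset.trans {p : R} {A B C : Matrix (Fin 3) (Fin 3) R} (h : SameCoset p A B)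
    (h' : SameCoset p B C) : SameCoset p A C := by
  obtain ⟨U, V, hU, hV, k, rfl⟩ := h
  obtain ⟨U', V', hU', hV', k', rfl⟩ := h'
  refine ⟨U * U', V' * V, by simp [hU, hU'], by simp [hV, hV'], k + k', ?_⟩
  simp [pow_add, mul_smul, Matrix.mul_assoc]

/-- The corner entry has the least valuation in its 2×2 block and serves as pivot; the determinant
forces the other exponent `m + a + b`. -/
lemma sameCoset_cornerMatrix_unit (p : R) (m a b c : ℕ) (u : Rˣ) :
    SameCoset p (cornerMatrix p (m + a) (m + b) c (p ^ m * u)) (diagPow p m c (m + a + b)) := by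
  refine ⟨!![1, 0, 0; 0, 1, 0; ↑u⁻¹ * p ^ a, 0, 1], !![p ^ b, 0, ↑u; 0, 1, 0; -↑u⁻¹, 0, 0],
    by simp [Matrix.det_fin_three], by simp [Matrix.det_fin_three], 0, ?_⟩
  have hu : (u : R) * (↑u⁻¹ : R) = 1 := u.mul_inv
  ext i j
  fin_cases i <;> fin_cases j <;>
    simp [cornerMatrix, diagPow, -Units.mul_inv, -Units.inv_mul] <;>
    first | ring1 | linear_combination -(p ^ (m + a)) * hu

lemma sameCoset_cornerMatrix_dvd (p : R) (a b c : ℕ) (w : R) :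
    SameCoset p (cornerMatrix p a b c (p ^ b * w)) (diagPow p b c a) := by
  refine ⟨1, !![1, 0, w; 0, 1, 0; 0, 0, 1], by simp, by simp [Matrix.det_fin_three], 0, ?_⟩
  ext i j
  fin_cases i <;> fin_cases j <;>
    simp [cornerMatrix, diagPow]

lemma sameCoset_diagPow_swap₂₃ (p : R) (a b c : ℕ) :
    SameCoset p (diagPow p a b c) (diagPow p a c b) := by
  refine ⟨!![1, 0, 0; 0, 0, 1; 0, -1, 0], !![1, 0, 0; 0, 0, -1; 0, 1, 0],
    by simp [Matrix.det_fin_three], by simp [Matrix.det_fin_three], 0, ?_⟩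
  ext i j
  fin_cases i <;> fin_cases j <;>
    simp [diagPow]

lemma sameCoset_diagPow_swap₁₂ (p : R) (a b c : ℕ) :
    SameCoset p (diagPow p a b c) (diagPow p b a c) := by
  refine ⟨!![0, 1, 0; -1, 0, 0; 0, 0, 1], !![0, -1, 0; 1, 0, 0; 0, 0, 1],
    by simp [Matrix.det_fin_three], by simp [Matrix.det_fin_three], 0, ?_⟩
  ext i j
  fin_cases i <;> fin_cases j <;>
    simp [diagPow]

lemma sameCoset_diagPow_add (p : R) (k a b c : ℕ) :
    SameCoset p (diagPow p (k + a) (k + b) (k + c)) (diagPow p a b c) := by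
  refine ⟨1, 1, by simp, by simp, k, ?_⟩
  ext i j
  fin_cases i <;> fin_cases j <;> simp [diagPow, pow_add]

end MatrixIdentities

/-! ### Integral matrices as elements of `G'`. -/

section Cls

variable {F : Type*} [Field F] [ValuativeRel F] (ϖ : 𝒪[F])

/-- The integral matrices whose determinant is a power of the uniformizer. -/
def powDet : Submonoid (Matrix (Fin 3) (Fin 3) 𝒪[F]) :=
  (Submonoid.powers ϖ).comap Matrix.detMonoidHom

lemma mem_powDet {A : Matrix (Fin 3) (Fin 3) 𝒪[F]} {k : ℕ} (h : A.det = ϖ ^ k) :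
    A ∈ powDet ϖ := ⟨k, h.symm⟩

lemma mem_powDet_of_det_eq_one {ϖ : 𝒪[F]} {A : Matrix (Fin 3) (Fin 3) 𝒪[F]} (hA : A.det = 1) :
    A ∈ powDet ϖ := mem_powDet ϖ (k := 0) (by rw [hA, pow_zero])

lemma diagPow_mem {ϖ : 𝒪[F]} (a b c : ℕ) : diagPow ϖ a b c ∈ powDet ϖ :=
  mem_powDet ϖ (k := a + b + c) (by simp [diagPow, Matrix.det_fin_three, pow_add])

variable [hϖ : Fact (Irreducible ϖ)]

lemma det_map_ne_zero (A : powDet ϖ) : (A.1.map (algebraMap 𝒪[F] F)).det ≠ 0 := by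
  obtain ⟨k, hk⟩ := A.2
  have : A.1.det = ϖ ^ k := hk.symm
  rw [← RingHom.mapMatrix_apply, ← RingHom.map_det, this, map_pow]
  exact pow_ne_zero k (unif ϖ).ne_zero

/-- The inclusion into `GL₃(F)` of the integral matrices whose determinant is a power of the
uniformizer. -/
def powDetToGL : powDet ϖ →* GL (Fin 3) F where
  toFun A := Matrix.GeneralLinearGroup.mkOfDetNeZero (A.1.map (algebraMap 𝒪[F] F))
    (det_map_ne_zero ϖ A)
  map_one' := by
    apply Units.ext
    change (1 : Matrix (Fin 3) (Fin 3) 𝒪[F]).map (algebraMap 𝒪[F] F) = 1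
    simp
  map_mul' A B := by
    apply Units.ext
    change (A.1 * B.1).map (algebraMap 𝒪[F] F) = A.1.map _ * B.1.map _
    rw [Matrix.map_mul]

lemma coe_powDetToGL (A : powDet ϖ) :
    (powDetToGL ϖ A : Matrix (Fin 3) (Fin 3) F) = A.1.map (algebraMap 𝒪[F] F) := rfl

lemma powDetToGL_mem (A : powDet ϖ) : powDetToGL ϖ A ∈ detPowers (unif ϖ) := by
  obtain ⟨k, hk⟩ := A.2
  have hk' : A.1.det = ϖ ^ k := hk.symm
  refine Subgroup.mem_zpowers_iff.mpr ⟨k, ?_⟩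
  apply Units.ext
  rw [Matrix.GeneralLinearGroup.val_det_apply, coe_powDetToGL, ← RingHom.mapMatrix_apply,
    ← RingHom.map_det, hk', map_pow, zpow_natCast, Units.val_pow_eq_pow_val]
  rfl

/-- The class in `G'` of an integral matrix whose determinant is a power of the uniformizer. -/
def powDetHom : powDet ϖ →* GPrime (unif ϖ) :=
  (QuotientGroup.mk' (scalarPowers (unif ϖ))).comp
    ((powDetToGL ϖ).codRestrict (detPowers (unif ϖ)) (powDetToGL_mem ϖ))

open Classical in
/-- The class in `G'` of an integral matrix whose determinant is a power of the uniformizer, with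
value `1` at other matrices. -/
def cls (A : Matrix (Fin 3) (Fin 3) 𝒪[F]) : GPrime (unif ϖ) :=
  if h : A ∈ powDet ϖ then powDetHom ϖ ⟨A, h⟩ else 1

variable {ϖ}

lemma cls_mul {A B : Matrix (Fin 3) (Fin 3) 𝒪[F]} (hA : A ∈ powDet ϖ) (hB : B ∈ powDet ϖ) :
    cls ϖ (A * B) = cls ϖ A * cls ϖ B := by
  rw [cls, cls, cls, dif_pos hA, dif_pos hB, dif_pos (mul_mem hA hB), ← map_mul]
  rfl

/-- Elements of `GL₃(F)` that differ by a power of the uniformizer have the same class. -/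
lemma mk_eq_mk_of_smul {g g' : detPowers (unif ϖ)} (k : ℕ)
    (h : ((g : GL (Fin 3) F) : Matrix (Fin 3) (Fin 3) F) =
      (ϖ : F) ^ k • ((g' : GL (Fin 3) F) : Matrix (Fin 3) (Fin 3) F)) :
    (QuotientGroup.mk g : GPrime (unif ϖ)) = QuotientGroup.mk g' := by
  symm
  rw [QuotientGroup.eq]
  refine Subgroup.mem_subgroupOf.mpr (Subgroup.mem_zpowers_iff.mpr ⟨k, ?_⟩)
  have hg : (g : GL (Fin 3) F) = g' * Matrix.GeneralLinearGroup.scalar (Fin 3) (unif ϖ) ^ k := by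
    apply Units.ext
    rw [h, ← map_pow, Units.val_mul, Matrix.GeneralLinearGroup.coe_scalar,
      Matrix.scalar_apply, ← Matrix.smul_one_eq_diagonal, Matrix.mul_smul, mul_one,
      Units.val_pow_eq_pow_val]
    rfl
  rw [zpow_natCast]
  simp [hg]

lemma cls_smul {A : Matrix (Fin 3) (Fin 3) 𝒪[F]} (hA : A ∈ powDet ϖ) (k : ℕ) :
    cls ϖ (ϖ ^ k • A) = cls ϖ A := by
  have hmem : ϖ ^ k • A ∈ powDet ϖ := by
    obtain ⟨l, hl⟩ := hA
    have hl' : A.det = ϖ ^ l := hl.symm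
    refine mem_powDet ϖ (k := 3 * k + l) ?_
    rw [Matrix.det_smul, hl', Fintype.card_fin]
    ring
  rw [cls, cls, dif_pos hA, dif_pos hmem]
  refine mk_eq_mk_of_smul k ?_
  change (ϖ ^ k • A).map (algebraMap 𝒪[F] F) = (ϖ : F) ^ k • A.map (algebraMap 𝒪[F] F)
  ext i j
  simp only [Matrix.map_apply, Matrix.smul_apply, smul_eq_mul, map_mul, map_pow]
  rfl

lemma cls_mem_maxCompact {A : Matrix (Fin 3) (Fin 3) 𝒪[F]} (hA : A.det = 1) :
    cls ϖ A ∈ maxCompact (unif ϖ) := by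
  refine ⟨⟨A, hA⟩, ?_⟩
  rw [cls, dif_pos (mem_powDet_of_det_eq_one hA)]
  exact congrArg QuotientGroup.mk (Subtype.ext (Units.ext rfl))

lemma diagElt_eq_cls (i j : ℕ) : diagElt (unif ϖ) i j = cls ϖ (diagPow ϖ 0 i (i + j)) := by
  rw [cls, dif_pos (diagPow_mem _ _ _)]
  symm
  refine mk_eq_mk_of_smul (i + j) ?_
  change (diagPow ϖ 0 i (i + j)).map (algebraMap 𝒪[F] F) =
    (ϖ : F) ^ (i + j) • (!![((unif ϖ ^ (-((i : ℤ) + j)) : Fˣ) : F), 0, 0;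
      0, ((unif ϖ ^ (-(j : ℤ)) : Fˣ) : F), 0; 0, 0, 1] : Matrix (Fin 3) (Fin 3) F)
  have h0 : (ϖ : F) ≠ 0 := (unif ϖ).ne_zero
  have h1 : ((unif ϖ : Fˣ) : F) = (ϖ : F) := rfl
  have h2 : algebraMap 𝒪[F] F ϖ = (ϖ : F) := rfl
  ext r s
  fin_cases r <;> fin_cases s <;>
    simp [diagPow, h1, h2, -neg_add_rev, zpow_neg, pow_add, zpow_add₀ h0] <;> field_simp

lemma SameCoset.exists_cls {A B : Matrix (Fin 3) (Fin 3) 𝒪[F]} (h : SameCoset ϖ A B)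
    (hB : B ∈ powDet ϖ) : ∃ k ∈ maxCompact (unif ϖ), ∃ k' ∈ maxCompact (unif ϖ),
      cls ϖ A = k * cls ϖ B * k' := by
  obtain ⟨U, V, hU, hV, k, rfl⟩ := h
  have hU' := mem_powDet_of_det_eq_one (ϖ := ϖ) hU
  have hV' := mem_powDet_of_det_eq_one (ϖ := ϖ) hV
  exact ⟨_, cls_mem_maxCompact hU, _, cls_mem_maxCompact hV, by
    rw [cls_smul (mul_mem (mul_mem hU' hB) hV'), cls_mul (mul_mem hU' hB) hV', cls_mul hU' hB]⟩

/-- An upper bound on the length is all that norm estimates need when `β ≥ 0`, so uniqueness of the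
Cartan decomposition plays no role. -/
lemma length_cls_le {A : Matrix (Fin 3) (Fin 3) 𝒪[F]} {i j : ℕ}
    (h : SameCoset ϖ A (diagPow ϖ 0 i (i + j))) : length (unif ϖ) (cls ϖ A) ≤ i + j := by
  obtain ⟨k, hk, k', hk', e⟩ := h.exists_cls (diagPow_mem _ _ _)
  exact Nat.sInf_le ⟨i, j, k, hk, k', hk', by rw [e, diagElt_eq_cls], rfl⟩

end Cls

/-! ### Matrix coefficients, norm bounds and jumps. -/

section Coefficients

variable {F : Type*} [Field F] [ValuativeRel F] {ϖ : 𝒪[F]} [hϖ : Fact (Irreducible ϖ)]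
  {E : Type*} [NormedAddCommGroup E] [NormedSpace ℂ E]
  {π : GPrime (unif ϖ) →* (E →L[ℂ] E)} {ξ : E} {η : StrongDual ℂ E}

lemma map_cls_mul_of_det_eq_one (hξ : IsInvariantVector (maxCompact (unif ϖ)) π ξ)
    {A U : Matrix (Fin 3) (Fin 3) 𝒪[F]} (hA : A ∈ powDet ϖ) (hU : U.det = 1) :
    π (cls ϖ (A * U)) ξ = π (cls ϖ A) ξ := by
  rw [cls_mul hA (mem_powDet_of_det_eq_one hU), map_mul]
  change π (cls ϖ A) (π (cls ϖ U) ξ) = _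
  rw [hξ _ (cls_mem_maxCompact hU)]

lemma SameCoset.coeff_eq (hξ : IsInvariantVector (maxCompact (unif ϖ)) π ξ)
    (hη : IsInvariantForm (maxCompact (unif ϖ)) π η) {A B : Matrix (Fin 3) (Fin 3) 𝒪[F]}
    (h : SameCoset ϖ A B) (hB : B ∈ powDet ϖ) :
    η (π (cls ϖ A) ξ) = η (π (cls ϖ B) ξ) := by
  obtain ⟨k, hk, k', hk', e⟩ := h.exists_cls hB
  rw [e, map_mul, map_mul]
  change η (π k (π (cls ϖ B) (π k' ξ))) = _
  rw [hξ _ hk']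
  have := hη k⁻¹ (inv_mem hk)
  rw [inv_inv] at this
  exact DFunLike.congr_fun this _

end Coefficients

section NormBound

variable {F : Type*} [Field F] [ValuativeRel F] [TopologicalSpace F] {ϖ : 𝒪[F]}
  [hϖ : Fact (Irreducible ϖ)] {E : Type*} [NormedAddCommGroup E] [NormedSpace ℂ E]
  [CompleteSpace E] {π : GPrime (unif ϖ) →* (E →L[ℂ] E)} {𝓔 : BanachClass}

lemma norm_map_cls_le {C β : ℝ} (hβ : 0 ≤ β)
    (hπ : MemRepClass 𝓔 (fun g => C + β * length (unif ϖ) g) π)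
    {A : Matrix (Fin 3) (Fin 3) 𝒪[F]} {i j : ℕ}
    (h : SameCoset ϖ A (diagPow ϖ 0 i (i + j))) :
    ‖π (cls ϖ A)‖ ≤ Real.exp (C + β * (i + j)) := by
  refine (hπ.norm_le _).trans (Real.exp_le_exp.2 ?_)
  have : (length (unif ϖ) (cls ϖ A) : ℝ) ≤ i + j := by exact_mod_cast length_cls_le h
  gcongr

end NormBound

section Jump

variable {F : Type*} [Field F] [ValuativeRel F] [TopologicalSpace F]
  [IsNonarchimedeanLocalField F] {ϖ : 𝒪[F]} [hϖ : Fact (Irreducible ϖ)]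
  {E : Type*} [NormedAddCommGroup E] [NormedSpace ℂ E]
  {π : GPrime (unif ϖ) →* (E →L[ℂ] E)} {ξ : E} {η : StrongDual ℂ E}

/-- The jump estimate for matrix coefficients, for families `A`, `B` of integral matrices such that
`A x t * B y z` is in the double coset of the corner matrix with entry `z - t - x y`. -/
lemma norm_coeff_sub_le {h : ℕ} (hh : 1 ≤ h) {r : ℝ} (hr0 : 0 ≤ r)
    (hr : FiniteFourier.transformNorm (𝒪[F] ⧸ Ideal.span {ϖ ^ h}) E ≤ r)
    (hξ : IsInvariantVector (maxCompact (unif ϖ)) π ξ)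
    (hη : IsInvariantForm (maxCompact (unif ϖ)) π η) (hξ1 : ‖ξ‖ = 1) (hη1 : ‖η‖ = 1)
    {a b c : ℕ} (hb : 1 ≤ b) (hab : b ≤ a) {A B : 𝒪[F] → 𝒪[F] → Matrix (Fin 3) (Fin 3) 𝒪[F]}
    (hA : ∀ x t, A x t ∈ powDet ϖ) (hB : ∀ y z, B y z ∈ powDet ϖ)
    (hAB : ∀ x t y z, SameCoset ϖ (A x t * B y z) (cornerMatrix ϖ a b c (z - t - x * y)))
    (hper : ∀ y z w w', ∃ U : Matrix (Fin 3) (Fin 3) 𝒪[F], U.det = 1 ∧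
      B (y + ϖ ^ b * w) (z + ϖ ^ b * w') = B y z * U)
    {M N : ℝ} (hM : ∀ x t, ‖π (cls ϖ (A x t))‖ ≤ M) (hN : ∀ y z, ‖π (cls ϖ (B y z))‖ ≤ N) :
    ‖η (π (cls ϖ (diagPow ϖ b c a)) ξ) - η (π (cls ϖ (diagPow ϖ (b - 1) c (a + 1))) ξ)‖ ≤
      FiniteFourier.level ϖ h * r ^ (b / h) * (M * N) := by
  have hcorner : ∀ s, cornerMatrix ϖ a b c s ∈ powDet ϖ := fun s =>
    mem_powDet ϖ (k := b + c + a) (by simp [cornerMatrix, Matrix.det_fin_three, pow_add])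
  have hunit : ∀ m, m ≤ b → ∀ u, IsUnit u →
      η (π (cls ϖ (cornerMatrix ϖ a b c (ϖ ^ m * u))) ξ) =
        η (π (cls ϖ (diagPow ϖ m c (a + b - m))) ξ) := by
    rintro m hm _ ⟨u, rfl⟩
    obtain ⟨b, rfl⟩ := Nat.exists_eq_add_of_le hm
    obtain ⟨a, rfl⟩ := Nat.exists_eq_add_of_le (hm.trans hab)
    have e : m + a + (m + b) - m = m + a + b := by omega
    rw [e]
    exact (sameCoset_cornerMatrix_unit ϖ m a b c u).coeff_eq hξ hη (diagPow_mem _ _ _)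
  have hnu : ∀ w : 𝒪[F], ¬ ϖ ∣ w → IsUnit w := by
    intro w hw
    by_contra hcon
    exact hw (Ideal.mem_span_singleton.1 (hϖ.out.maximalIdeal_eq ▸
      (IsLocalRing.mem_maximalIdeal w).2 hcon))
  refine FiniteFourier.norm_jump_le (p := ϖ) (E := E) hϖ.out hh hr0 hr hb
    (ξ := fun y z => π (cls ϖ (B y z)) ξ) (η := fun x t => η.comp (π (cls ϖ (A x t))))
    (f := fun s => η (π (cls ϖ (cornerMatrix ϖ a b c s)) ξ)) ?_ ?_ ?_ ?_ ?_ ?_ ?_ ?_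
  · intro y w
    funext z
    obtain ⟨U, hU, e⟩ := hper y z w 0
    rw [mul_zero, add_zero] at e
    simp only [e]
    exact map_cls_mul_of_det_eq_one hξ (hB y z) hU
  · intro y z w
    obtain ⟨U, hU, e⟩ := hper y z 0 w
    rw [mul_zero, add_zero] at e
    simp only [e]
    exact map_cls_mul_of_det_eq_one hξ (hB y z) hU
  · intro x t y z
    change η (π (cls ϖ (A x t)) (π (cls ϖ (B y z)) ξ)) = _
    rw [← (hAB x t y z).coeff_eq hξ hη (hcorner _), cls_mul (hA x t) (hB y z), map_mul]
    rfl
  · intro x t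
    refine (ContinuousLinearMap.opNorm_comp_le _ _).trans ?_
    rw [hη1, one_mul]
    exact hM x t
  · intro y z
    refine (ContinuousLinearMap.le_opNorm _ _).trans ?_
    rw [hξ1, mul_one]
    exact hN y z
  · intro w
    exact (sameCoset_cornerMatrix_dvd ϖ a b c w).coeff_eq hξ hη (diagPow_mem _ _ _)
  · intro w hw
    have e : a + b - (b - 1) = a + 1 := by omega
    rw [← e]
    exact hunit (b - 1) (Nat.sub_le _ _) w (hnu w hw)
  -- If `s` has valuation below `b - 1`, adding an element of `ϖ^(b-1) 𝒪` changes only its unit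
  -- part.
  · intro s w hs
    have hs0 : s ≠ 0 := fun h0 => hs (h0 ▸ dvd_zero _)
    obtain ⟨m, u, rfl⟩ := IsDiscreteValuationRing.eq_unit_mul_pow_irreducible hs0 hϖ.out
    have hm : m < b - 1 := by
      by_contra hcon
      exact hs (Dvd.dvd.mul_left (pow_dvd_pow ϖ (not_lt.1 hcon)) _)
    have e : (u : 𝒪[F]) * ϖ ^ m + ϖ ^ (b - 1) * w =
        ϖ ^ m * (u + ϖ * (ϖ ^ (b - 1 - m - 1) * w)) := by
      have : ϖ ^ (b - 1) = ϖ ^ m * (ϖ * ϖ ^ (b - 1 - m - 1)) := by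
        rw [← pow_succ', ← pow_add]; congr 1; omega
      rw [this]; ring
    have hu : IsUnit ((u : 𝒪[F]) + ϖ * (ϖ ^ (b - 1 - m - 1) * w)) := by
      refine hnu _ fun hd => hϖ.out.not_isUnit (isUnit_of_dvd_unit ?_ u.isUnit)
      exact (dvd_add_left (dvd_mul_right _ _)).1 hd
    rw [e, hunit m (by omega) _ hu, mul_comm, hunit m (by omega) _ u.isUnit]

variable [CompleteSpace E] {𝓔 : BanachClass}

/-- Below the diagonal, `c(i, j)` is close to `c(i + 2, j - 1)`. -/
lemma norm_coeff_sub_le_of_le {h : ℕ} (hh : 1 ≤ h) {r : ℝ} (hr0 : 0 ≤ r)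
    (hr : FiniteFourier.transformNorm (𝒪[F] ⧸ Ideal.span {ϖ ^ h}) E ≤ r)
    {C β : ℝ} (hβ : 0 ≤ β) (hπ : MemRepClass 𝓔 (fun g => C + β * length (unif ϖ) g) π)
    (hξ : IsInvariantVector (maxCompact (unif ϖ)) π ξ)
    (hη : IsInvariantForm (maxCompact (unif ϖ)) π η) (hξ1 : ‖ξ‖ = 1) (hη1 : ‖η‖ = 1)
    (i j : ℕ) :
    ‖η (π (diagElt (unif ϖ) i (j + 1)) ξ) - η (π (diagElt (unif ϖ) (i + 2) j) ξ)‖ ≤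
      FiniteFourier.level ϖ h * r ^ ((j + 1) / h) *
        (Real.exp (C + β * (i + j + 1)) * Real.exp (C + β * (j + 1))) := by
  -- With `c = a + b` the middle exponent is the largest both before and after the jump; reordering
  -- and removing the common power of `ϖ` gives the two indices.
  have key := norm_coeff_sub_le (ϖ := ϖ) (π := π) hh hr0 hr hξ hη hξ1 hη1 (a := i + j + 1)
    (b := j + 1) (c := i + j + 1 + (j + 1))
    (A := fun x t => !![1, -x, -t; 0, ϖ ^ (i + j + 1), 0; 0, 0, ϖ ^ (i + j + 1)])
    (B := fun y z => !![ϖ ^ (j + 1), 0, z; 0, ϖ ^ (j + 1), y; 0, 0, 1])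
    (M := Real.exp (C + β * (i + j + 1))) (N := Real.exp (C + β * (j + 1)))
    (by omega) (by omega) ?_ ?_ ?_ ?_ ?_ ?_
  · refine le_trans (le_of_eq ?_) key
    congr 2
    · rw [diagElt_eq_cls]
      symm
      refine SameCoset.coeff_eq hξ hη ?_ (diagPow_mem _ _ _)
      refine SameCoset.trans ?_ (sameCoset_diagPow_swap₂₃ _ _ _ _)
      convert sameCoset_diagPow_add ϖ (j + 1) 0 (i + (j + 1)) i using 2 <;> omega
    · rw [diagElt_eq_cls]
      symm
      refine SameCoset.coeff_eq hξ hη ?_ (diagPow_mem _ _ _)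
      refine SameCoset.trans ?_ (sameCoset_diagPow_swap₂₃ _ _ _ _)
      convert sameCoset_diagPow_add ϖ j 0 (i + 2 + j) (i + 2) using 2 <;> omega
  · intro x t
    exact mem_powDet ϖ (k := i + j + 1 + (i + j + 1)) (by simp [Matrix.det_fin_three]; ring)
  · intro y z
    exact mem_powDet ϖ (k := j + 1 + (j + 1)) (by simp [Matrix.det_fin_three]; ring)
  · intro x t y z
    -- The product has corner `z - t - x y`; a row operation by `y` and a column operation by `x`
    -- account for its other off-diagonal entries.
    refine ⟨!![1, 0, 0; 0, 1, y; 0, 0, 1], !![1, -x, 0; 0, 1, 0; 0, 0, 1],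
      by simp [Matrix.det_fin_three], by simp [Matrix.det_fin_three], 0, ?_⟩
    ext r s
    fin_cases r <;> fin_cases s <;>
      simp [cornerMatrix, Matrix.mul_apply, Fin.sum_univ_three] <;> ring
  · intro y z w w'
    refine ⟨!![1, 0, w'; 0, 1, w; 0, 0, 1], by simp [Matrix.det_fin_three], ?_⟩
    ext r s
    fin_cases r <;> fin_cases s <;>
      simp [Matrix.mul_apply, Fin.sum_univ_three] <;> ring
  · intro x t
    have : SameCoset ϖ !![1, -x, -t; 0, ϖ ^ (i + j + 1), 0; 0, 0, ϖ ^ (i + j + 1)]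
        (diagPow ϖ 0 (i + j + 1) (i + j + 1 + 0)) := by
      refine ⟨1, !![1, -x, -t; 0, 1, 0; 0, 0, 1], by simp, by simp [Matrix.det_fin_three], 0, ?_⟩
      ext r s
      fin_cases r <;> fin_cases s <;>
        simp [diagPow]
    simpa [add_assoc] using norm_map_cls_le hβ hπ this
  · intro y z
    have : SameCoset ϖ !![ϖ ^ (j + 1), 0, z; 0, ϖ ^ (j + 1), y; 0, 0, 1]
        (diagPow ϖ 0 (j + 1) (j + 1 + 0)) := by
      refine SameCoset.trans ?_ ((sameCoset_diagPow_swap₂₃ ϖ (j + 1) (j + 1) 0).trans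
        (sameCoset_diagPow_swap₁₂ ϖ (j + 1) 0 (j + 1)))
      refine ⟨!![1, 0, z; 0, 1, y; 0, 0, 1], 1, by simp [Matrix.det_fin_three], by simp, 0, ?_⟩
      ext r s
      fin_cases r <;> fin_cases s <;>
        simp [diagPow]
    simpa using norm_map_cls_le hβ hπ this

/-- Above the diagonal, `c(i, j)` is close to `c(i - 1, j + 2)`. -/
lemma norm_coeff_sub_le_of_ge {h : ℕ} (hh : 1 ≤ h) {r : ℝ} (hr0 : 0 ≤ r)
    (hr : FiniteFourier.transformNorm (𝒪[F] ⧸ Ideal.span {ϖ ^ h}) E ≤ r)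
    {C β : ℝ} (hβ : 0 ≤ β) (hπ : MemRepClass 𝓔 (fun g => C + β * length (unif ϖ) g) π)
    (hξ : IsInvariantVector (maxCompact (unif ϖ)) π ξ)
    (hη : IsInvariantForm (maxCompact (unif ϖ)) π η) (hξ1 : ‖ξ‖ = 1) (hη1 : ‖η‖ = 1)
    (i j : ℕ) :
    ‖η (π (diagElt (unif ϖ) (i + 1) j) ξ) - η (π (diagElt (unif ϖ) i (j + 2)) ξ)‖ ≤
      FiniteFourier.level ϖ h * r ^ ((i + 1) / h) *
        (Real.exp (C + β * (i + j + 1)) * Real.exp (C + β * (i + 1))) := by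
  -- Here the middle exponent is `0`, the smallest one, so no common power of `ϖ` has to be removed.
  have key := norm_coeff_sub_le (ϖ := ϖ) (π := π) hh hr0 hr hξ hη hξ1 hη1 (a := i + j + 1)
    (b := i + 1) (c := 0)
    (A := fun x t => !![1, 0, -t; 0, 1, x; 0, 0, ϖ ^ (i + j + 1)])
    (B := fun y z => !![ϖ ^ (i + 1), y, z; 0, 1, 0; 0, 0, 1])
    (M := Real.exp (C + β * (i + j + 1))) (N := Real.exp (C + β * (i + 1)))
    (by omega) (by omega) ?_ ?_ ?_ ?_ ?_ ?_
  · refine le_trans (le_of_eq ?_) key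
    congr 2
    · rw [diagElt_eq_cls]
      symm
      refine SameCoset.coeff_eq hξ hη ?_ (diagPow_mem _ _ _)
      convert sameCoset_diagPow_swap₁₂ ϖ (i + 1) 0 (i + j + 1) using 2
      omega
    · rw [diagElt_eq_cls]
      symm
      refine SameCoset.coeff_eq hξ hη ?_ (diagPow_mem _ _ _)
      convert sameCoset_diagPow_swap₁₂ ϖ i 0 (i + j + 1 + 1) using 2
      all_goals omega
  · intro x t
    exact mem_powDet ϖ (k := i + j + 1) (by simp [Matrix.det_fin_three])
  · intro y z
    exact mem_powDet ϖ (k := i + 1) (by simp [Matrix.det_fin_three])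
  · intro x t y z
    refine ⟨!![1, y, 0; 0, 1, 0; 0, 0, 1], !![1, 0, 0; 0, 1, x; 0, 0, 1],
      by simp [Matrix.det_fin_three], by simp [Matrix.det_fin_three], 0, ?_⟩
    ext r s
    fin_cases r <;> fin_cases s <;>
      simp [cornerMatrix, Matrix.mul_apply, Fin.sum_univ_three]
    ring
  · intro y z w w'
    refine ⟨!![1, w, w'; 0, 1, 0; 0, 0, 1], by simp [Matrix.det_fin_three], ?_⟩
    ext r s
    fin_cases r <;> fin_cases s <;>
      simp [Matrix.mul_apply, Fin.sum_univ_three] <;> ring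
  · intro x t
    have : SameCoset ϖ !![1, 0, -t; 0, 1, x; 0, 0, ϖ ^ (i + j + 1)]
        (diagPow ϖ 0 0 (0 + (i + j + 1))) := by
      refine ⟨1, !![1, 0, -t; 0, 1, x; 0, 0, 1], by simp, by simp [Matrix.det_fin_three], 0, ?_⟩
      ext r s
      fin_cases r <;> fin_cases s <;>
        simp [diagPow]
    simpa using norm_map_cls_le hβ hπ this
  · intro y z
    have : SameCoset ϖ !![ϖ ^ (i + 1), y, z; 0, 1, 0; 0, 0, 1]
        (diagPow ϖ 0 0 (0 + (i + 1))) := by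
      rw [zero_add]
      refine SameCoset.trans ?_ ((sameCoset_diagPow_swap₁₂ ϖ (i + 1) 0 0).trans
        (sameCoset_diagPow_swap₂₃ ϖ 0 (i + 1) 0))
      refine ⟨!![1, y, z; 0, 1, 0; 0, 0, 1], 1, by simp [Matrix.det_fin_three], by simp, 0, ?_⟩
      ext r s
      fin_cases r <;> fin_cases s <;>
        simp [diagPow]
    simpa using norm_map_cls_le hβ hπ this

end Jump

end LocalSL3

end

noncomputable section

/-! ### Summing the jumps. -/

namespace LocalSL3

lemma mem_weightSet {i j : ℕ} : (i, j) ∈ weightSet ↔ (3 : ℤ) ∣ (i : ℤ) - j := Iff.rfl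

/-- A function on `ℕ²` whose jumps `(i, j) → (i + 2, j - 1)` below the diagonal and
`(i, j) → (i - 1, j + 2)` above the diagonal decay geometrically has a limit along `Λ`. -/
lemma exists_limit_of_jumps {c : ℕ → ℕ → ℂ} {K q : ℝ} (hq0 : 0 < q) (hq1 : q < 1)
    (h₁ : ∀ i j, i ≤ j + 1 → ‖c i (j + 1) - c (i + 2) j‖ ≤ K * q ^ (i + j + 1))
    (h₂ : ∀ i j, j ≤ i + 1 → ‖c (i + 1) j - c i (j + 2)‖ ≤ K * q ^ (i + j + 1)) :
    ∃ l : ℂ, ∀ i j, (i, j) ∈ weightSet → 1 ≤ i + j →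
      ‖c i j - l‖ ≤ K / (1 - q) * q ^ (i + j) := by
  -- Two neighbouring diagonal points are joined through `(m + 3, m)`, by one move of each kind.
  have hd : ∀ m, dist (c (m + 1) (m + 1)) (c (m + 1 + 1) (m + 1 + 1)) ≤
      K * (1 + q) * q ^ 2 * (q ^ 2) ^ m := by
    intro m
    have e₁ := h₁ (m + 1) m le_rfl
    have e₂ := h₂ (m + 2) m (by omega)
    rw [dist_eq_norm]
    calc _ ≤ ‖c (m + 1) (m + 1) - c (m + 1 + 2) m‖ + ‖c (m + 2 + 1) m - c (m + 2) (m + 2)‖ :=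
          norm_sub_le_norm_sub_add_norm_sub _ _ _
      _ ≤ _ := add_le_add e₁ e₂
      _ = _ := by ring
  have hq2 : q ^ 2 < 1 := by nlinarith
  have hq1' : 0 < 1 - q := sub_pos.2 hq1
  obtain ⟨l, hl⟩ := cauchySeq_tendsto_of_complete (cauchySeq_of_le_geometric _ _ hq2 hd)
  have hdiag : ∀ m, ‖c (m + 1) (m + 1) - l‖ ≤ K / (1 - q) * q ^ (m + 1 + (m + 1)) := by
    intro m
    rw [← dist_eq_norm]
    refine (dist_le_of_le_geometric_of_tendsto _ _ hq2 hd hl m).trans (le_of_eq ?_)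
    have : 1 - q ^ 2 = (1 - q) * (1 + q) := by ring
    have h3 : 0 < 1 + q := by linarith
    rw [this]
    field_simp
    ring
  -- The constant `K / (1 - q)` is stable under a move: `K + K / (1 - q) * q = K / (1 - q)`.
  have hstep : ∀ {x y : ℂ} {n : ℕ}, ‖x - y‖ ≤ K * q ^ n → ‖y - l‖ ≤ K / (1 - q) * q ^ (n + 1) →
      ‖x - l‖ ≤ K / (1 - q) * q ^ n := by
    intro x y n hxy hy
    refine (norm_sub_le_norm_sub_add_norm_sub x y l).trans ((add_le_add hxy hy).trans
      (le_of_eq ?_))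
    field_simp
    ring
  -- Each move towards the diagonal lowers `|i - j|` by `3` and raises `i + j` by `1`; `k` counts
  -- the moves left.
  have hall : ∀ k i j : ℕ, 1 ≤ i + j → (i = j + 3 * k ∨ j = i + 3 * k) →
      ‖c i j - l‖ ≤ K / (1 - q) * q ^ (i + j) := by
    intro k
    induction k with
    | zero =>
      intro i j hij h
      obtain rfl : i = j := by omega
      obtain ⟨m, rfl⟩ := Nat.exists_eq_add_of_le' (show 1 ≤ i by omega)
      exact hdiag m
    | succ k ih =>
      rintro i j hij (h | h)
      · obtain ⟨i, rfl⟩ := Nat.exists_eq_add_of_le' (show 1 ≤ i by omega)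
        have := ih i (j + 2) (by omega) (by omega)
        rw [show i + 1 + j = i + j + 1 by ring]
        exact hstep (h₂ i j (by omega)) this
      · obtain ⟨j, rfl⟩ := Nat.exists_eq_add_of_le' (show 1 ≤ j by omega)
        have := ih (i + 2) j (by omega) (by omega)
        rw [show i + 2 + j = i + j + 1 + 1 by ring] at this
        exact hstep (h₁ i j (by omega)) this
  refine ⟨l, fun i j hij h1 => ?_⟩
  obtain ⟨k, hk⟩ := mem_weightSet.1 hij
  exact hall k.natAbs i j h1 (by omega)

lemma tendsto_weightSet_atTop :
    Filter.Tendsto (fun p : weightSet => (p.1.1 + p.1.2 : ℝ)) Filter.cofinite Filter.atTop := by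
  have : Filter.Tendsto (fun p : weightSet => p.1.1 + p.1.2) Filter.cofinite Filter.atTop := by
    refine Filter.tendsto_atTop.2 fun b => ?_
    rw [Filter.eventually_cofinite]
    refine Set.Finite.subset (Set.Finite.preimage Subtype.val_injective.injOn
      ((Set.finite_Iio b).prod (Set.finite_Iio b))) fun p hp => ?_
    simp only [not_le, Set.mem_ofPred_eq] at hp
    exact ⟨by simp; omega, by simp; omega⟩
  exact ((tendsto_natCast_atTop_atTop (R := ℝ)).comp this).congr fun p => by simp

/-- The gain of the Fourier transform of level `n` against the growth of the representation. -/
lemma jump_bound {h : ℕ} (hh : 1 ≤ h) {α β C : ℝ} (hα : 0 < α) (hβα : β < α / (3 * h))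
    {i n : ℕ} (hin : i ≤ n) {L : ℝ} (hL : 0 ≤ L) :
    L * Real.exp (-α) ^ (n / h) * (Real.exp (C + β * (i + n)) * Real.exp (C + β * n)) ≤
      L * Real.exp α * Real.exp (2 * C) * Real.exp (-(α / (3 * h) - β)) ^ (i + n) := by
  have hh0 : (0 : ℝ) < h := by exact_mod_cast hh
  -- Rounding down loses at most one factor `e^{-α}`, which is the origin of `Real.exp α` in the
  -- bound.
  have hfloor : (n : ℝ) / h - 1 ≤ (n / h : ℕ) := by
    have h1 : n < h * (n / h + 1) := Nat.lt_mul_div_succ n hh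
    have h2 : (n : ℝ) < h * ((n / h : ℕ) + 1) := by exact_mod_cast h1
    have h3 : (n : ℝ) / h < (n / h : ℕ) + 1 := by rw [div_lt_iff₀ hh0]; linarith
    linarith
  rw [mul_assoc, mul_assoc L, mul_assoc L]
  refine mul_le_mul_of_nonneg_left ?_ hL
  rw [← Real.exp_nat_mul, ← Real.exp_nat_mul, ← Real.exp_add, ← Real.exp_add, ← Real.exp_add,
    ← Real.exp_add, Real.exp_le_exp]
  set δ := α / (3 * h) with hδ
  have hαδ : α * ((n : ℝ) / h) = 3 * δ * n := by rw [hδ]; field_simp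
  have hin' : (i : ℝ) ≤ n := by exact_mod_cast hin
  have hδ0 : 0 < δ := by positivity
  have hn0 : (0 : ℝ) ≤ n := Nat.cast_nonneg n
  have e1 := mul_le_mul_of_nonneg_left hfloor hα.le
  push_cast
  -- After cancellation the claim is `β n + δ i ≤ 2 δ n`, which follows from `i ≤ n` and `β < δ`.
  nlinarith [mul_le_mul_of_nonneg_left hin' hδ0.le, mul_le_mul_of_nonneg_right hβα.le hn0]

end LocalSL3

end

/-! ### The main theorem. -/

theorem proposition4p5
    {F : Type u} [Field F] [ValuativeRel F] [TopologicalSpace F] [IsNonarchimedeanLocalField F]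
    (ϖ : 𝒪[F]) [Fact (Irreducible ϖ)]
    (h : ℕ) (hh : 1 ≤ h) (α : ℝ) (hα : 0 < α)
    (𝓔 : BanachClass.{v})
    (h𝓔 : ∀ (E : Type v) [NormedAddCommGroup E] [NormedSpace ℂ E] [CompleteSpace E], 𝓔 E →
      FiniteFourier.transformNorm (𝒪[F] ⧸ Ideal.span {ϖ ^ h}) E ≤ Real.exp (-α))
    (β : ℝ) (hβ : 0 ≤ β) (hβα : β < α / (3 * h)) :
    ∃ C' : ℝ, 0 < C' ∧ ∀ C : ℝ, 0 ≤ C →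
      ∀ (E : Type v) [NormedAddCommGroup E] [NormedSpace ℂ E] [CompleteSpace E]
        (π : LocalSL3.GPrime (LocalSL3.unif ϖ) →* (E →L[ℂ] E)),
      MemRepClass 𝓔 (fun g => C + β * LocalSL3.length (LocalSL3.unif ϖ) g) π →
      ∀ (ξ : E) (η : StrongDual ℂ E), ‖ξ‖ = 1 → ‖η‖ = 1 →
      IsInvariantVector (LocalSL3.maxCompact (LocalSL3.unif ϖ)) π ξ →
      IsInvariantForm (LocalSL3.maxCompact (LocalSL3.unif ϖ)) π η →
      ∃ c_inf : ℂ,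
        Filter.Tendsto
          (fun p : LocalSL3.weightSet =>
            η (π (LocalSL3.diagElt (LocalSL3.unif ϖ) p.1.1 p.1.2) ξ))
          Filter.cofinite (nhds c_inf) ∧
        ∀ i j : ℕ, (i, j) ∈ LocalSL3.weightSet →
          ‖η (π (LocalSL3.diagElt (LocalSL3.unif ϖ) i j) ξ) - c_inf‖ ≤
            C' * Real.exp (2 * C - (α / (3 * h) - β) * (i + j)) := by
  set γ := α / (3 * h) - β with hγ
  have hγ0 : 0 < γ := sub_pos.2 hβα
  set q := Real.exp (-γ) with hq
  have hq0 : 0 < q := Real.exp_pos _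
  have hq1 : q < 1 := by rw [hq]; simpa using hγ0
  have hq1' : 0 < 1 - q := sub_pos.2 hq1
  set L : ℝ := FiniteFourier.level ϖ h * Real.exp α with hL
  have hL0 : 0 ≤ L := by positivity
  -- The first term is the geometric tail; `1 + Real.exp (2 * β)` serves only the origin, which no
  -- jump reaches and which is compared with `(1, 1)` by crude norm bounds.
  refine ⟨L / (1 - q) + 1 + Real.exp (2 * β), by positivity, ?_⟩
  intro C hC E _ _ _ π hπ ξ η hξ1 hη1 hξ hη
  have hr := h𝓔 E hπ.mem
  have hr0 := (Real.exp_pos (-α)).le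
  set c : ℕ → ℕ → ℂ := fun i j => η (π (LocalSL3.diagElt (LocalSL3.unif ϖ) i j) ξ) with hc
  obtain ⟨l, hl⟩ := LocalSL3.exists_limit_of_jumps (c := c) (K := L * Real.exp (2 * C)) (q := q)
    hq0 hq1
    (fun i j hij => by
      refine (LocalSL3.norm_coeff_sub_le_of_le hh hr0 hr hβ hπ hξ hη hξ1 hη1 i j).trans ?_
      have := LocalSL3.jump_bound (C := C) hh hα hβα hij
        (Nat.cast_nonneg (FiniteFourier.level ϖ h))
      push_cast at this
      simpa only [add_assoc] using this)
    (fun i j hij => by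
      refine (LocalSL3.norm_coeff_sub_le_of_ge hh hr0 hr hβ hπ hξ hη hξ1 hη1 i j).trans ?_
      have := LocalSL3.jump_bound (C := C) hh hα hβα hij
        (Nat.cast_nonneg (FiniteFourier.level ϖ h))
      push_cast at this
      rw [← add_assoc, ← add_assoc, add_comm (j : ℝ) i, add_comm j i] at this
      exact this)
  have hexp : ∀ i j : ℕ, Real.exp (2 * C) * q ^ (i + j) = Real.exp (2 * C - γ * (i + j)) := by
    intro i j
    rw [hq, ← Real.exp_nat_mul, ← Real.exp_add]
    congr 1
    push_cast
    ring
  have hcnorm : ∀ i j : ℕ, ‖c i j‖ ≤ Real.exp (C + β * (i + j)) := by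
    intro i j
    have h1 : ‖π (LocalSL3.diagElt (LocalSL3.unif ϖ) i j)‖ ≤ Real.exp (C + β * (i + j)) := by
      rw [LocalSL3.diagElt_eq_cls]
      exact LocalSL3.norm_map_cls_le hβ hπ (LocalSL3.SameCoset.refl _ _)
    calc ‖c i j‖ ≤ ‖η‖ * (‖π (LocalSL3.diagElt (LocalSL3.unif ϖ) i j)‖ * ‖ξ‖) :=
          (η.le_opNorm _).trans (mul_le_mul_of_nonneg_left (ContinuousLinearMap.le_opNorm _ _)
            (norm_nonneg _))
      _ ≤ _ := by rwa [hξ1, hη1, one_mul, mul_one]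
  have hbound : ∀ i j : ℕ, (i, j) ∈ LocalSL3.weightSet →
      ‖c i j - l‖ ≤ (L / (1 - q) + 1 + Real.exp (2 * β)) * Real.exp (2 * C - γ * (i + j)) := by
    intro i j hij
    have hpos := Real.exp_pos (2 * C)
    have hpos' := Real.exp_pos (2 * β)
    rcases Nat.eq_zero_or_pos (i + j) with h0 | h0
    · obtain ⟨rfl, rfl⟩ : i = 0 ∧ j = 0 := by omega
      have e1 := hl 1 1 (by simp [LocalSL3.mem_weightSet]) (by norm_num)
      have e2 := hcnorm 0 0
      have e3 := hcnorm 1 1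
      have hC2 : Real.exp C ≤ Real.exp (2 * C) := Real.exp_le_exp.2 (by linarith)
      have e4 : Real.exp (C + β * ((1 : ℕ) + (1 : ℕ))) = Real.exp (2 * β) * Real.exp C := by
        rw [← Real.exp_add]; congr 1; push_cast; ring
      have e5 : L * Real.exp (2 * C) / (1 - q) * q ^ (1 + 1) ≤
          L / (1 - q) * Real.exp (2 * C) := by
        rw [div_mul_eq_mul_div L]
        exact mul_le_of_le_one_right (by positivity) (pow_le_one₀ hq0.le hq1.le)
      have e6 := mul_le_mul_of_nonneg_left hC2 hpos'.le
      rw [e4] at e3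
      simp only [Nat.cast_zero, add_zero, mul_zero, sub_zero] at e2 ⊢
      calc ‖c 0 0 - l‖ ≤ ‖c 0 0‖ + (‖c 1 1‖ + ‖c 1 1 - l‖) := by
            have : c 0 0 - l = c 0 0 - c 1 1 + (c 1 1 - l) := by ring
            rw [this, ← add_assoc]
            exact (norm_add_le _ _).trans (by gcongr; exact norm_sub_le _ _)
        _ ≤ _ := by linarith
    · refine (hl i j hij h0).trans ?_
      rw [← hexp]
      have : L * Real.exp (2 * C) / (1 - q) * q ^ (i + j) =
          L / (1 - q) * (Real.exp (2 * C) * q ^ (i + j)) := by ring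
      rw [this]
      refine mul_le_mul_of_nonneg_right ?_ (by positivity)
      linarith
  refine ⟨l, ?_, hbound⟩
  rw [tendsto_iff_norm_sub_tendsto_zero]
  refine squeeze_zero (fun _ => norm_nonneg _) (fun p => hbound p.1.1 p.1.2 p.2) ?_
  rw [← mul_zero (L / (1 - q) + 1 + Real.exp (2 * β))]
  refine Filter.Tendsto.const_mul _ (Real.tendsto_exp_atBot.comp ?_)
  refine Filter.tendsto_atBot_add_const_left _ (2 * C) ?_ |>.congr fun p => (sub_eq_add_neg _ _).symm
  exact Filter.tendsto_neg_atTop_atBot.comp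
    (LocalSL3.tendsto_weightSet_atTop.const_mul_atTop hγ0)
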